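/- Let $E,F$ be Polish spaces with their Borel $\sigma$-algebras and let $\{P_x:x\in F\}$ be a family of Markov kernels on $E$ such that $(x,y)\mapsto P_x(y,A)$ is measurable for every Borel set $A\subseteq E$. Let $((X_t,Y_t))_{t\in\mathbb Z}$ be a stationary process with values in $F\times E$ such that, for all $t\in\mathbb Z$ and all Borel sets $A\subseteq E$, almost surely, $$\mathbb P\big(Y_t\in A\mid (X_s)_{s\in\mathbb Z},\,Y_{t-1},Y_{t-2},\ldots\big)=P_{X_{t-1}}(Y_{t-1},A).$$ For a process $(W_t)_{t\in\mathbb Z}$ put, for integers $n\ge 0$, $\alpha_W(n)=\sup|\mathbb P(A\cap B)-\mathbb P(A)\mathbb P(B)|$, where the supremum is over $A\in\sigma(W_j:j\le 0)$ and $B\in\sigma(W_j:j\ge n)$; $W$ is called strongly mixing if $\alpha_W(n)\to0$ as $n\to\infty$. Fix an integer $m\ge 1$ and set $Z_t=(X_t,X_{t+1},\ldots,X_{t+m-1})$. Assume: (A1) $(X_t)_{t\in\mathbb Z}$ is stationary and strongly mixing. (A2) There are a measurable map $z\mapsto\eta_z$ from $F^m$ to $(0,1)$ and, for each $z\in F^m$,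 a probability measure $\nu_z$ on $E$ such that, almost surely, $P_{X_1}P_{X_2}\cdots P_{X_m}(x,A)\ge \eta_{Z_1}\nu_{Z_1}(A)$ for all $x\in E$ and all Borel sets $A\subseteq E$. Here $P_{X_1}\cdots P_{X_m}$ is the composition in which the transition by $P_{X_1}$ is performed first. Set $\rho=1-\mathbb E\,\eta_{Z_0}$, $V_t=(X_t,Y_t)$ and, for integers $r\le t$, $s_t(r)=[(t-r)/m]$, where $[\cdot]$ is the integer part. Then: 1. For all integers $n,r$ with $1\le r\le n-1$, $$\alpha_V(n)\le 4\alpha_X(r)+2\sum_{t\ge n}\ \inf_{1\le j\le s_t(r)-1}\Big\{\rho^{[s_t(r)/j]}+4\,\frac{\alpha_X((j-1)m+1)}{1-\rho}\Big\},$$ where the infimum over the empty set is $+\infty$. 2. If $\alpha_X(n)=O(n^{-\kappa})$ with $\kappa>1$, then for every real $\kappa'$ with $1<\kappa'<\kappa$ the process $(V_t)_{t\in\mathbb Z}$ is strongly mixing with $\alpha_V(n)=O(n^{-\kappa'+1})$. If $\alpha_X(n)=O(\kappa^n)$ with $\kappa\in(0,1)$, then there exists $\overline\kappa\in(0,1)$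 such that $\alpha_V(n)=O(\overline\kappa^{\sqrt n})$. -/

import Mathlib

open MeasureTheory ProbabilityTheory Filter Topology Asymptotics
open scoped ENNReal

noncomputable section

namespace MCRE

/-! ### Stationarity and strong mixing -/

/-- A two-sided process is (strictly) stationary if the law of the whole trajectory is invariant
under all time shifts. -/
def IsStationary {Ω H : Type*} [MeasurableSpace Ω] [MeasurableSpace H]
    (μ : Measure Ω) (V : ℤ → Ω → H) : Prop :=
  ∀ k : ℤ, μ.map (fun ω t => V (t + k) ω) = μ.map (fun ω t => V t ω)

/-- The strong mixing coefficient of two sigma-algebras: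
the supremum of `|μ (A ∩ B) - μ A * μ B|` over `A` in the first and `B` in the second one. -/
def alphaCoeff {Ω : Type*} [MeasurableSpace Ω] (μ : Measure Ω) (𝓕 𝓖 : MeasurableSpace Ω) : ℝ :=
  sSup {a : ℝ | ∃ A B : Set Ω, MeasurableSet[𝓕] A ∧ MeasurableSet[𝓖] B ∧
    a = |μ.real (A ∩ B) - μ.real A * μ.real B|}

/-- The sigma-algebra generated by `V j`, `j ≤ k`. -/
@[reducible] def pastSigma {Ω H : Type*} [MeasurableSpace H] (V : ℤ → Ω → H) (k : ℤ) : MeasurableSpace Ω :=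
  ⨆ (j : ℤ) (_ : j ≤ k), MeasurableSpace.comap (V j) inferInstance

/-- The sigma-algebra generated by `V j`, `j ≥ k`. -/
@[reducible] def futureSigma {Ω H : Type*} [MeasurableSpace H] (V : ℤ → Ω → H) (k : ℤ) : MeasurableSpace Ω :=
  ⨆ (j : ℤ) (_ : k ≤ j), MeasurableSpace.comap (V j) inferInstance

/-- The strong mixing coefficient of order `n` of the process `V`. -/
def alphaMix {Ω H : Type*} [MeasurableSpace Ω] [MeasurableSpace H]
    (μ : Measure Ω) (V : ℤ → Ω → H) (n : ℕ) : ℝ :=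
  alphaCoeff μ (pastSigma V 0) (futureSigma V n)

/-- The process `V` is strongly mixing. -/
def IsStronglyMixing {Ω H : Type*} [MeasurableSpace Ω] [MeasurableSpace H]
    (μ : Measure Ω) (V : ℤ → Ω → H) : Prop :=
  Tendsto (alphaMix μ V) atTop (𝓝 0)

/-! ### Markov chains in random environments

The family of kernels `P_x`, `x ∈ F`, on `E` is given as one kernel `P` from `F × E` to `E`,
`P_x(y, A) = P (x, y) A`; this contains the joint measurability in `(x, y)`. -/

/-- The sigma-algebra generated by the whole environment `X` and by `Y s`, `s < t`. -/
@[reducible] def envSigma {Ω E F : Type*} [MeasurableSpace E] [MeasurableSpace F]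
    (X : ℤ → Ω → F) (Y : ℤ → Ω → E) (t : ℤ) : MeasurableSpace Ω :=
  (⨆ s : ℤ, MeasurableSpace.comap (X s) inferInstance) ⊔
    ⨆ (s : ℤ) (_ : s < t), MeasurableSpace.comap (Y s) inferInstance

/-- `Y` is a (two-sided) Markov chain in the random environment `X` with kernels `P`: almost surely,
`ℙ(Y t ∈ A | X, Y (t-1), Y (t-2), …) = P_{X (t-1)}(Y (t-1), A)`. -/
structure IsChainInRandomEnv {Ω E F : Type*} [MeasurableSpace Ω] [MeasurableSpace E]
    [MeasurableSpace F] (μ : Measure Ω) (P : Kernel (F × E) E)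
    (X : ℤ → Ω → F) (Y : ℤ → Ω → E) : Prop where
  measurable_env : ∀ t, Measurable (X t)
  measurable_chain : ∀ t, Measurable (Y t)
  condProb : ∀ (t : ℤ) (A : Set E), MeasurableSet A →
    μ⟦Y t ⁻¹' A | envSigma X Y t⟧ =ᵐ[μ] fun ω => (P (X (t - 1) ω, Y (t - 1) ω)).real A

/-- The product `P_{z 0} P_{z 1} ⋯ P_{z (m-1)}` of the kernels on `E`: the transition by `P_{z 0}`
is performed first. -/
def kernelProd {E F : Type*} [MeasurableSpace E] [MeasurableSpace F] (P : Kernel (F × E) E) :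
    (m : ℕ) → (Fin m → F) → Kernel E E
  | 0, _ => Kernel.id
  | m + 1, z => kernelProd P m (Fin.tail z) ∘ₖ Kernel.sectR P (z 0)

/-- The block `Z t = (X t, X (t+1), …, X (t+m-1))`. -/
def envBlock {Ω F : Type*} (X : ℤ → Ω → F) (m : ℕ) (t : ℤ) (ω : Ω) : Fin m → F :=
  fun i => X (t + (i : ℕ)) ω

/-- The random Doeblin condition: almost surely,
`P_{X 1} ⋯ P_{X m}(x, A) ≥ η_{Z 1} ν_{Z 1}(A)` for all `x ∈ E` and all Borel sets `A`. -/
structure IsDoeblin {Ω E F : Type*} [MeasurableSpace Ω] [MeasurableSpace E] [MeasurableSpace F]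
    (μ : Measure Ω) (P : Kernel (F × E) E) (X : ℤ → Ω → F) (m : ℕ)
    (η : (Fin m → F) → ℝ) (ν : (Fin m → F) → Measure E) : Prop where
  measurable_eta : Measurable η
  eta_mem : ∀ z, η z ∈ Set.Ioo (0 : ℝ) 1
  prob_nu : ∀ z, IsProbabilityMeasure (ν z)
  minorization : ∀ᵐ ω ∂μ, ∀ (x : E) (A : Set E), MeasurableSet A →
    ENNReal.ofReal (η (envBlock X m 1 ω)) * ν (envBlock X m 1 ω) A
      ≤ kernelProd P m (envBlock X m 1 ω) x A

/-- `inf_{1 ≤ j ≤ s - 1} { ρ ^ [s / j] + 4 α ((j - 1) m + 1) / (1 - ρ) }` as an element of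
`[0, ∞]`; the infimum over the empty set is `∞`. -/
def infTerm (α : ℕ → ℝ) (ρ : ℝ) (m s : ℕ) : ℝ≥0∞ :=
  ⨅ (j : ℕ) (_ : 1 ≤ j ∧ j < s),
    ENNReal.ofReal (ρ ^ (s / j) + 4 * (α ((j - 1) * m + 1) / (1 - ρ)))

end MCRE

end

noncomputable section

namespace MCRE

/-! ### Null sets among analytic sets -/

/-! Given the environment, the chain forgets its state: over each block of `m` steps the transition
operator shrinks oscillations in the state by the factor `1 - η`. Hence, for an event `B` of times
`≥ n`, its probability given `X` and the chain up to time `r` can be replaced by a function `fB` of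
`X s`, `s ≥ r`, at the cost of `d`, the expected product of these factors over the `(n - r) / m`
blocks between `r` and `n` (`exists_env_approx`). An event `A` of times in `[-K, 0]` is replaced in
the same way by a function `fA` of `X s`, `s ≤ 0`, by starting the chain so far before `-K` that the
cost is at most `ε / 2`; this is why events are first reduced to finite windows. What remains is a
covariance of functions of the environment separated by a gap `r`, so `α_V(n) ≤ α_X(r) + 2 d`
(`alphaMix_le_add_integral_contraction`).

To bound `d`, keep one block out of every `j`. The remaining factors are nearly independent, and an
induction with the covariance inequality gives `d ≤ ρ ^ (s / j) + α_X((j - 1) m + 1) / (1 - ρ)` with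
`s = (n - r) / m` (`integral_prod_blocks_le`). The series in the theorem is then bounded below by
its single term `t = n`. Both rates come from `r ≈ n / 2` and a suitable growth of `j` with `n`.

The minorization is assumed only at time 1 and outside a null set of `ω`. To move it to other times
it must become a statement about the law of `X`. It quantifies over uncountably many states, so the
exceptional set of paths is a projection, analytic but perhaps not Borel;
`measure_eq_zero_of_analyticSet` handles this. -/

lemma exists_initial_box_subset {n : ℕ → ℕ} {V : Set (ℕ → ℕ)} (hV : IsOpen V)
    (h : {x : ℕ → ℕ | ∀ i, x i ≤ n i} ⊆ V) : ∃ k, {x : ℕ → ℕ | ∀ i < k, x i ≤ n i} ⊆ V := by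
  by_contra! hcon
  choose y hy using fun k => Set.not_subset.1 (hcon k)
  have hK : IsCompact {x : ℕ → ℕ | ∀ i, x i ≤ n i} := by
    have : {x : ℕ → ℕ | ∀ i, x i ≤ n i} = Set.univ.pi fun i => Set.Iic (n i) := by
      ext x; simp [Pi.le_def]
    rw [this]
    exact isCompact_univ_pi fun i => (Set.finite_Iic (n i)).isCompact
  -- `y k` obeys only the first `k` bounds. Padding with zeros puts it in the compact box without
  -- changing coordinatewise limits.
  let y' : ℕ → ℕ → ℕ := fun k i => if i < k then y k i else 0
  have hy' : ∀ k, y' k ∈ {x : ℕ → ℕ | ∀ i, x i ≤ n i} := by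
    intro k i
    by_cases hi : i < k
    · simpa [y', hi] using (hy k).1 i hi
    · simp [y', hi]
  obtain ⟨z, hz, φ, hφ, hlim⟩ := hK.tendsto_subseq hy'
  have hlim' : Tendsto (y ∘ φ) atTop (𝓝 z) := by
    rw [tendsto_pi_nhds] at hlim ⊢
    intro i
    refine (hlim i).congr' ?_
    filter_upwards [hφ.tendsto_atTop.eventually_gt_atTop i] with k hk
    simp [y', hk]
  have : z ∈ Vᶜ := hV.isClosed_compl.mem_of_tendsto hlim' (Eventually.of_forall fun k => (hy _).2)
  exact this (h hz)

/-- An analytic set all of whose compact subsets are null is itself null. -/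
lemma measure_eq_zero_of_analyticSet {α : Type*} [TopologicalSpace α] [PolishSpace α]
    [MeasurableSpace α] [BorelSpace α] (ν : Measure α) [IsFiniteMeasure ν] {s : Set α}
    (hs : AnalyticSet s) (hK : ∀ K ⊆ s, IsCompact K → ν K = 0) : ν s = 0 := by
  rw [AnalyticSet] at hs
  obtain rfl | ⟨f, hf, rfl⟩ := hs
  · simp
  by_contra hne
  obtain ⟨c, hc0, hc⟩ := exists_between (pos_iff_ne_zero.2 hne)
  -- Continuity from below holds for increasing sets that need not be measurable, so each coordinate
  -- can be bounded in turn while the image keeps outer measure above `c`.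
  have step : ∀ (S : Set (ℕ → ℕ)) (k : ℕ), ∃ m : ℕ, c < ν (f '' S) →
      c < ν (f '' (S ∩ {x | x k ≤ m})) := by
    intro S k
    have hmono : Monotone fun m : ℕ => f '' (S ∩ {x | x k ≤ m}) := by
      intro a b hab
      refine Set.image_mono (Set.inter_subset_inter_right _ fun x hx => ?_)
      exact le_trans hx hab
    have hU : ⋃ m : ℕ, f '' (S ∩ {x | x k ≤ m}) = f '' S := by
      rw [← Set.image_iUnion, ← Set.inter_iUnion]
      congr 1
      refine Set.inter_eq_left.2 fun x _ => Set.mem_iUnion.2 ⟨x k, by simp⟩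
    have hlim := tendsto_measure_iUnion_atTop (μ := ν) hmono
    rw [hU] at hlim
    by_cases hS : c < ν (f '' S)
    · obtain ⟨m, hm⟩ := (hlim.eventually (lt_mem_nhds hS)).exists
      exact ⟨m, fun _ => hm⟩
    · exact ⟨0, fun h => absurd h hS⟩
  choose m hm using step
  let S : ℕ → Set (ℕ → ℕ) := fun k =>
    Nat.rec Set.univ (fun k T => T ∩ {x | x k ≤ m T k}) k
  have hSsucc : ∀ k, S (k + 1) = S k ∩ {x | x k ≤ m (S k) k} := fun k => rfl
  have hS : ∀ k, S k = {x | ∀ i < k, x i ≤ m (S i) i} := by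
    intro k
    induction k with
    | zero => simp [S]
    | succ k ih =>
      rw [hSsucc]
      ext x
      have hx : x ∈ S k ↔ ∀ i < k, x i ≤ m (S i) i := by
        conv_lhs => rw [ih]
        simp
      simp only [hx, Set.mem_inter_iff, Set.mem_ofPred_eq, Nat.forall_lt_succ_right]
  have hSc : ∀ k, c < ν (f '' S k) := by
    intro k
    induction k with
    | zero => simpa [S] using hc
    | succ k ih => exact hm _ _ ih
  have hcpt : IsCompact {x : ℕ → ℕ | ∀ i, x i ≤ m (S i) i} := by
    have : {x : ℕ → ℕ | ∀ i, x i ≤ m (S i) i} = Set.univ.pi fun i => Set.Iic (m (S i) i) := by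
      ext x; simp [Pi.le_def]
    rw [this]
    exact isCompact_univ_pi fun i => (Set.finite_Iic _).isCompact
  have h0 := hK _ (Set.image_subset_range f _) (hcpt.image hf)
  let := TopologicalSpace.upgradeIsCompletelyMetrizable α
  -- The image of the compact box is null, hence lies in an open set of measure below `c`. That set
  -- already contains the image of a box with finitely many bounds, which has measure above `c`.
  obtain ⟨U, hUs, hUo, hUc⟩ := Set.exists_isOpen_lt_of_lt (μ := ν) _ c (h0.trans_lt hc0)
  obtain ⟨k, hk⟩ := exists_initial_box_subset (hUo.preimage hf) (Set.image_subset_iff.1 hUs)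
  rw [← hS k] at hk
  exact absurd ((hSc k).trans_le (measure_mono (Set.image_subset_iff.2 hk))) (not_lt.2 hUc.le)

/-- A property of `x` of the form "for all `y`, a measurable relation holds" can be transferred
from a random variable to its law. -/
lemma ae_map_forall_of_ae_forall {Ω α β : Type*} [MeasurableSpace Ω] {μ : Measure Ω}
    [IsFiniteMeasure μ] [TopologicalSpace α] [PolishSpace α] [MeasurableSpace α] [BorelSpace α]
    [TopologicalSpace β] [PolishSpace β] [MeasurableSpace β] [BorelSpace β]
    {Z : Ω → α} (hZ : Measurable Z) {D : Set (α × β)} (hD : MeasurableSet D)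
    (h : ∀ᵐ ω ∂μ, ∀ y, (Z ω, y) ∈ D) : ∀ᵐ x ∂(μ.map Z), ∀ y, (x, y) ∈ D := by
  have : {x | ¬ ∀ y, (x, y) ∈ D} = Prod.fst '' Dᶜ := by
    ext x; simp
  rw [ae_iff, this]
  refine measure_eq_zero_of_analyticSet _ (hD.compl.analyticSet.image_of_continuous
    continuous_fst) fun K hKs hK => ?_
  -- The law can be computed from a preimage here because a compact set is measurable, unlike the
  -- projection itself.
  rw [Measure.map_apply hZ hK.measurableSet]
  refine measure_mono_null (fun ω hω => ?_) (ae_iff.1 h)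
  rw [← this] at hKs
  exact hKs hω

/-! ### Transition operators along an environment path -/

section Transition

variable {E F : Type*} [MeasurableSpace E] [MeasurableSpace F]

/-- One transition at time `c` along the environment path `x`, acting on functions of the path and
of the state. -/
def stepOp (P : Kernel (F × E) E) (c : ℤ) (h : (ℤ → F) → E → ℝ≥0∞) (x : ℤ → F) (y : E) : ℝ≥0∞ :=
  ∫⁻ y', h x y' ∂(P (x c, y))

/-- The transitions at times `c, …, c + N - 1`, the one at time `c` being performed first. -/
def iterOp (P : Kernel (F × E) E) : ℤ → ℕ → ((ℤ → F) → E → ℝ≥0∞) → (ℤ → F) → E → ℝ≥0∞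
  | _, 0, h => h
  | c, N + 1, h => stepOp P c (iterOp P (c + 1) N h)

/-- The environment block of length `m` read off a path at time `c`. -/
def pathBlock (m : ℕ) (c : ℤ) (x : ℤ → F) : Fin m → F := fun i => x (c + (i : ℕ))

/-- The time shift of paths. -/
def shiftPath (k : ℤ) (x : ℤ → F) : ℤ → F := fun t => x (t + k)

@[fun_prop]
lemma measurable_shiftPath (k : ℤ) : Measurable (shiftPath (F := F) k) :=
  measurable_pi_lambda _ fun _ => measurable_pi_apply _

@[fun_prop]
lemma measurable_pathBlock (m : ℕ) (c : ℤ) : Measurable (pathBlock (F := F) m c) :=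
  measurable_pi_lambda _ fun _ => measurable_pi_apply _

variable {P : Kernel (F × E) E}

lemma measurable_stepOp [IsMarkovKernel P] (c : ℤ) {h : (ℤ → F) → E → ℝ≥0∞}
    (hh : Measurable (Function.uncurry h)) :
    Measurable (Function.uncurry (stepOp P c h)) := by
  have hφ : Measurable fun p : (ℤ → F) × E => (p.1 c, p.2) := by fun_prop
  have := Measurable.lintegral_kernel_prod_right (κ := P.comap _ hφ)
    (f := fun (p : (ℤ → F) × E) y' => h p.1 y')
    (hh.comp (f := fun q : ((ℤ → F) × E) × E => (q.1.1, q.2)) (by fun_prop))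
  exact this

lemma measurable_iterOp [IsMarkovKernel P] (c : ℤ) (N : ℕ) {h : (ℤ → F) → E → ℝ≥0∞}
    (hh : Measurable (Function.uncurry h)) :
    Measurable (Function.uncurry (iterOp P c N h)) := by
  induction N generalizing c with
  | zero => exact hh
  | succ N ih => exact measurable_stepOp c (ih (c + 1))

lemma stepOp_le_one [IsMarkovKernel P] (c : ℤ) {h : (ℤ → F) → E → ℝ≥0∞} (hh : ∀ x y, h x y ≤ 1)
    (x : ℤ → F) (y : E) : stepOp P c h x y ≤ 1 :=
  (lintegral_mono fun _ => hh _ _).trans (by simp)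

lemma iterOp_le_one [IsMarkovKernel P] (c : ℤ) (N : ℕ) {h : (ℤ → F) → E → ℝ≥0∞}
    (hh : ∀ x y, h x y ≤ 1) (x : ℤ → F) (y : E) : iterOp P c N h x y ≤ 1 := by
  induction N generalizing c x y with
  | zero => exact hh x y
  | succ N ih => exact stepOp_le_one c (fun x y => ih (c + 1) x y) x y

lemma iterOp_add (c : ℤ) (a b : ℕ) (h : (ℤ → F) → E → ℝ≥0∞) :
    iterOp P c (a + b) h = iterOp P c a (iterOp P (c + a) b h) := by
  induction a generalizing c with
  | zero => simp [iterOp]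
  | succ a ih =>
    rw [show a + 1 + b = (a + b) + 1 by ring]
    simp only [iterOp, ih]
    rw [show c + 1 + (a : ℤ) = c + ((a + 1 : ℕ) : ℤ) by push_cast; ring]

lemma iterOp_shiftPath (c k : ℤ) (N : ℕ) (h : (ℤ → F) → E → ℝ≥0∞) (x : ℤ → F) :
    iterOp P c N h (shiftPath k x) = iterOp P (c + k) N (fun x => h (shiftPath k x)) x := by
  induction N generalizing c with
  | zero => rfl
  | succ N ih =>
    ext y
    simp only [iterOp, stepOp, ih]
    rw [show c + 1 + k = c + k + 1 by ring]
    rfl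

/-- `kernelProd` is a kernel in the state only and carries no measurability in the block, whereas
`iterOp` is jointly measurable in path and state. For a fixed path the two agree, which brings in
the Doeblin condition. -/
lemma iterOp_eq_lintegral_kernelProd (c : ℤ) (N : ℕ) {h : (ℤ → F) → E → ℝ≥0∞} (x : ℤ → F)
    (hh : Measurable (h x)) (y : E) :
    iterOp P c N h x y = ∫⁻ y', h x y' ∂(kernelProd P N (pathBlock N c x) y) := by
  induction N generalizing c y with
  | zero => simp [iterOp, kernelProd, Kernel.id_apply, lintegral_dirac' _ hh]
  | succ N ih =>
    have htail : Fin.tail (pathBlock (N + 1) c x) = pathBlock N (c + 1) x := by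
      ext i
      simp only [Fin.tail, pathBlock, Fin.val_succ]
      congr 1
      push_cast
      ring
    simp only [iterOp, stepOp, ih, kernelProd, htail]
    rw [Kernel.lintegral_comp _ _ _ hh, Kernel.sectR_apply]
    simp [pathBlock]

lemma DependsOn.iterOp {S : Set ℤ} {h : (ℤ → F) → E → ℝ≥0∞} (hh : ∀ y, DependsOn (fun x => h x y) S)
    (c : ℤ) (N : ℕ) (hS : ∀ i : ℤ, c ≤ i → i < c + N → i ∈ S) (y : E) :
    DependsOn (fun x => iterOp P c N h x y) S := by
  induction N generalizing c y with
  | zero => exact hh y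
  | succ N ih =>
    intro x x' hx
    have h1 : ∀ y', MCRE.iterOp P (c + 1) N h x y' = MCRE.iterOp P (c + 1) N h x' y' := fun y' =>
      ih (c + 1) (fun i hi hi' => hS i (by omega) (by push_cast; omega)) y' hx
    simp only [MCRE.iterOp, stepOp, h1, hx c (hS c le_rfl (by push_cast; omega))]

/-- The Doeblin contraction of oscillations. -/
lemma lintegral_le_lintegral_add_of_minorization {κ₁ κ₂ ν : Measure E} [IsProbabilityMeasure κ₁]
    [IsProbabilityMeasure κ₂] [IsProbabilityMeasure ν] {e δ : ℝ≥0∞} (he : e ≤ 1)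
    (h₁ : e • ν ≤ κ₁) (h₂ : e • ν ≤ κ₂) {h : E → ℝ≥0∞}
    (hδ : ∀ y y', h y ≤ h y' + δ) :
    ∫⁻ y, h y ∂κ₁ ≤ ∫⁻ y, h y ∂κ₂ + (1 - e) * δ := by
  have hetop : e ≠ ∞ := ne_top_of_le_ne_top ENNReal.one_ne_top he
  have hfin : IsFiniteMeasure (e • ν) := ⟨by simpa using hetop.lt_top⟩
  -- After removing the common part `e • ν`, both residual measures have mass `1 - e`. Comparing `h`
  -- with the constant `⨅ y', h y'` under each of them yields the factor `1 - e`.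
  have split : ∀ κ : Measure E, IsProbabilityMeasure κ → e • ν ≤ κ →
      ∫⁻ y, h y ∂κ = ∫⁻ y, h y ∂(κ - e • ν) + e * ∫⁻ y, h y ∂ν ∧
        (κ - e • ν) Set.univ = 1 - e := by
    intro κ hκ hle
    constructor
    · conv_lhs => rw [← Measure.sub_add_cancel_of_le hle]
      rw [lintegral_add_measure, lintegral_smul_measure, smul_eq_mul]
    · rw [Measure.sub_apply MeasurableSet.univ hle]
      simp
  obtain ⟨e₁, m₁⟩ := split κ₁ inferInstance h₁
  obtain ⟨e₂, m₂⟩ := split κ₂ inferInstance h₂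
  have hne : Nonempty E := (nonempty_of_isProbabilityMeasure κ₁)
  have hup : ∀ y, h y ≤ (⨅ y', h y') + δ := fun y => by
    rw [ENNReal.iInf_add]
    exact le_iInf fun y' => hδ y y'
  calc ∫⁻ y, h y ∂κ₁ ≤ ∫⁻ _, ((⨅ y', h y') + δ) ∂(κ₁ - e • ν) + e * ∫⁻ y, h y ∂ν := by
        rw [e₁]; gcongr; exact hup _
    _ = ∫⁻ _, (⨅ y', h y') ∂(κ₂ - e • ν) + e * ∫⁻ y, h y ∂ν + (1 - e) * δ := by
        simp only [lintegral_const, m₁, m₂]; ring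
    _ ≤ ∫⁻ y, h y ∂(κ₂ - e • ν) + e * ∫⁻ y, h y ∂ν + (1 - e) * δ := by
        gcongr; exact iInf_le _ _
    _ = _ := by rw [← e₂]

/-- The product of the contraction coefficients over the first `s` blocks after time `c`. -/
def contraction {m : ℕ} (η : (Fin m → F) → ℝ) (c : ℤ) (s : ℕ) (x : ℤ → F) : ℝ :=
  ∏ i ∈ Finset.range s, (1 - η (pathBlock m (c + i * m) x))

lemma measurable_contraction {m : ℕ} {η : (Fin m → F) → ℝ} (hη : Measurable η) (c : ℤ) (s : ℕ) :
    Measurable (contraction η c s) := by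
  unfold contraction
  fun_prop

lemma contraction_nonneg {F : Type*} {m : ℕ} {η : (Fin m → F) → ℝ}
    (hη : ∀ z, η z ∈ Set.Ioo (0 : ℝ) 1) (c : ℤ) (s : ℕ) (x : ℤ → F) :
    0 ≤ contraction η c s x :=
  Finset.prod_nonneg fun _ _ => sub_nonneg.2 (hη _).2.le

lemma contraction_le_one {F : Type*} {m : ℕ} {η : (Fin m → F) → ℝ}
    (hη : ∀ z, η z ∈ Set.Ioo (0 : ℝ) 1) (c : ℤ) (s : ℕ) (x : ℤ → F) :
    contraction η c s x ≤ 1 :=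
  Finset.prod_le_one (fun _ _ => sub_nonneg.2 (hη _).2.le) fun _ _ =>
    sub_le_self _ (hη _).1.le

end Transition

/-! ### Contraction along a stationary environment -/

section Contraction

variable {Ω E F : Type*} [MeasurableSpace Ω] {μ : Measure Ω} [IsProbabilityMeasure μ]
    [TopologicalSpace E] [PolishSpace E] [MeasurableSpace E] [BorelSpace E]
    [TopologicalSpace F] [PolishSpace F] [MeasurableSpace F] [BorelSpace F]
    {P : Kernel (F × E) E} [IsMarkovKernel P] {X : ℤ → Ω → F} {m : ℕ}
    {η : (Fin m → F) → ℝ} {ν : (Fin m → F) → Measure E}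

/-- The law of the trajectory of a process. -/
def pathLaw {Ω F : Type*} [MeasurableSpace Ω] [MeasurableSpace F] (μ : Measure Ω)
    (X : ℤ → Ω → F) : Measure (ℤ → F) := μ.map fun ω t => X t ω

instance kernelProd_isMarkov {E F : Type*} [MeasurableSpace E] [MeasurableSpace F]
    (P : Kernel (F × E) E) [IsMarkovKernel P] (m : ℕ) (z : Fin m → F) :
    IsMarkovKernel (kernelProd P m z) := by
  induction m with
  | zero => simp only [kernelProd]; infer_instance
  | succ m ih =>
    have := ih (Fin.tail z)
    simp only [kernelProd]
    infer_instance

lemma measurePreserving_shiftPath {Ω F : Type*} [MeasurableSpace Ω] [MeasurableSpace F]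
    {μ : Measure Ω} {X : ℤ → Ω → F} (hX : ∀ t, Measurable (X t)) (hstat : IsStationary μ X)
    (k : ℤ) : MeasurePreserving (shiftPath k) (pathLaw μ X) (pathLaw μ X) := by
  refine ⟨measurable_shiftPath k, ?_⟩
  have := hstat k
  rw [pathLaw, Measure.map_map (measurable_shiftPath k) (measurable_pi_lambda _ hX)]
  exact this

/-- One block contracts the oscillation. At time 1 this is the minorization, transferred from `ω` to
the law of the path; stationarity then shifts it to any time `c`. -/
lemma ae_iterOp_block_le (hX : ∀ t, Measurable (X t)) (hstat : IsStationary μ X)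
    (hD : IsDoeblin μ P X m η ν) (c : ℤ) {h : (ℤ → F) → E → ℝ≥0∞}
    (hh : Measurable (Function.uncurry h)) {δ : (ℤ → F) → ℝ≥0∞} (hδ : Measurable δ)
    (hosc : ∀ᵐ x ∂(pathLaw μ X), ∀ y y', h x y ≤ h x y' + δ x) :
    ∀ᵐ x ∂(pathLaw μ X), ∀ y y', iterOp P c m h x y ≤
      iterOp P c m h x y' + ENNReal.ofReal (1 - η (pathBlock m c x)) * δ x := by
  have hXm : Measurable fun ω t => X t ω := measurable_pi_lambda _ hX
  suffices H : ∀ (h : (ℤ → F) → E → ℝ≥0∞) (_ : Measurable (Function.uncurry h))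
      (δ : (ℤ → F) → ℝ≥0∞) (_ : Measurable δ)
      (_ : ∀ᵐ x ∂(pathLaw μ X), ∀ y y', h x y ≤ h x y' + δ x),
      ∀ᵐ x ∂(pathLaw μ X), ∀ y y', iterOp P 1 m h x y ≤
        iterOp P 1 m h x y' + ENNReal.ofReal (1 - η (pathBlock m 1 x)) * δ x by
    have hinv : ∀ x : ℤ → F, shiftPath (1 - c) (shiftPath (c - 1) x) = x := by
      intro x
      ext t
      simp only [shiftPath]
      congr 1
      ring
    have hmp := measurePreserving_shiftPath hX hstat
    have h1 := H (fun x => h (shiftPath (1 - c) x))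
      (hh.comp (f := fun p : (ℤ → F) × E => (shiftPath (1 - c) p.1, p.2)) (by fun_prop))
      (fun x => δ (shiftPath (1 - c) x)) (by fun_prop)
      ((hmp (1 - c)).quasiMeasurePreserving.ae hosc)
    filter_upwards [(hmp (c - 1)).quasiMeasurePreserving.ae h1] with x hx y y'
    have := hx y y'
    simp only [iterOp_shiftPath, hinv, add_sub_cancel] at this
    have hb : pathBlock m 1 (shiftPath (c - 1) x) = pathBlock m c x := by
      ext i
      simp only [pathBlock, shiftPath]
      congr 1
      ring
    rwa [hb] at this
  clear! h δ
  intro h hh δ hδ hosc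
  have hmeas : MeasurableSet {p : (ℤ → F) × E × E | iterOp P 1 m h p.1 p.2.1 ≤
      iterOp P 1 m h p.1 p.2.2 + ENNReal.ofReal (1 - η (pathBlock m 1 p.1)) * δ p.1} := by
    have hη := hD.measurable_eta
    have hi := measurable_iterOp (P := P) 1 m hh
    have hi1 : Measurable fun p : (ℤ → F) × E × E => iterOp P 1 m h p.1 p.2.1 :=
      hi.comp (f := fun p : (ℤ → F) × E × E => (p.1, p.2.1)) (by fun_prop)
    have hi2 : Measurable fun p : (ℤ → F) × E × E => iterOp P 1 m h p.1 p.2.2 :=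
      hi.comp (f := fun p : (ℤ → F) × E × E => (p.1, p.2.2)) (by fun_prop)
    exact measurableSet_le hi1 (by fun_prop)
  have := ae_map_forall_of_ae_forall (μ := μ) hXm hmeas (by
    filter_upwards [ae_of_ae_map hXm.aemeasurable hosc, hD.minorization] with ω hω hmin
    rintro ⟨y, y'⟩
    have hz : envBlock X m 1 ω = pathBlock m 1 (fun t => X t ω) := rfl
    have hhx : Measurable (h fun t => X t ω) := hh.comp measurable_prodMk_left
    have hη := hD.eta_mem (pathBlock m 1 (fun t => X t ω))
    have := hD.prob_nu (pathBlock m 1 (fun t => X t ω))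
    rw [hz] at hmin
    have hle : ∀ y, ENNReal.ofReal (η (pathBlock m 1 (fun t => X t ω))) •
        ν (pathBlock m 1 (fun t => X t ω)) ≤
          kernelProd P m (pathBlock m 1 (fun t => X t ω)) y := fun y =>
      Measure.le_iff.2 fun A hA => by simpa using hmin y A hA
    simp only [iterOp_eq_lintegral_kernelProd 1 m _ hhx]
    rw [ENNReal.ofReal_sub _ hη.1.le, ENNReal.ofReal_one]
    exact lintegral_le_lintegral_add_of_minorization (by simpa using hη.2.le) (hle y) (hle y') hω)
  filter_upwards [this] with x hx y y'
  exact hx (y, y')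

/-- Almost surely, the oscillation of the iterated transition is at most the product of the
contraction coefficients. -/
lemma ae_iterOp_le (hX : ∀ t, Measurable (X t)) (hstat : IsStationary μ X)
    (hD : IsDoeblin μ P X m η ν) (c : ℤ) (N : ℕ) {h : (ℤ → F) → E → ℝ≥0∞}
    (hh : Measurable (Function.uncurry h)) (h1 : ∀ x y, h x y ≤ 1) :
    ∀ᵐ x ∂(pathLaw μ X), ∀ y y', iterOp P c N h x y ≤
      iterOp P c N h x y' + ENNReal.ofReal (contraction η c (N / m) x) := by
  have key : ∀ (s : ℕ) (c : ℤ) (h : (ℤ → F) → E → ℝ≥0∞), Measurable (Function.uncurry h) →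
      (∀ x y, h x y ≤ 1) → ∀ᵐ x ∂(pathLaw μ X), ∀ y y', iterOp P c (m * s) h x y ≤
        iterOp P c (m * s) h x y' + ENNReal.ofReal (contraction η c s x) := by
    intro s
    induction s with
    | zero =>
      intro c h _ h1
      filter_upwards with x y y'
      simpa [contraction, iterOp] using le_add_left (h1 x y)
    | succ s ih =>
      intro c h hh h1
      have := ae_iterOp_block_le hX hstat hD c (measurable_iterOp (c + m) (m * s) hh)
        (measurable_contraction hD.measurable_eta (c + m) s).ennreal_ofReal (ih (c + m) h hh h1)
      filter_upwards [this] with x hx y y'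
      have hc : contraction η c (s + 1) x =
          (1 - η (pathBlock m c x)) * contraction η (c + m) s x := by
        rw [contraction, Finset.prod_range_succ', mul_comm]
        simp only [Nat.cast_zero, zero_mul, add_zero]
        congr 1
        refine Finset.prod_congr rfl fun i _ => ?_
        congr 3
        push_cast
        ring
      rw [show m * (s + 1) = m + m * s by ring, iterOp_add, hc,
        ENNReal.ofReal_mul (sub_nonneg.2 (hD.eta_mem _).2.le)]
      exact hx y y'
  -- The last `N % m` transitions are absorbed into the function, so that only full blocks remain.
  have := key (N / m) c (iterOp P (c + (m * (N / m) : ℕ)) (N % m) h) (measurable_iterOp _ _ hh)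
    (iterOp_le_one _ _ h1)
  rwa [← iterOp_add, Nat.div_add_mod] at this

end Contraction

/-! ### The Markov property of the chain given the environment -/

section Markov

/-- The path `y` before time `t`, continued by the constant `e`. -/
def truncPath {E : Type*} (e : E) (t : ℤ) (y : ℤ → E) : ℤ → E := fun s => if s < t then y s else e

lemma measurable_envSigma_truncPath {Ω E F : Type*} [MeasurableSpace E] [MeasurableSpace F]
    {X : ℤ → Ω → F} {Y : ℤ → Ω → E} (e : E) (t : ℤ) :
    Measurable[envSigma X Y t] fun ω => ((fun s => X s ω), truncPath e t fun s => Y s ω) := by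
  refine Measurable.prodMk (m := envSigma X Y t) ?_ ?_
  · refine @measurable_pi_lambda _ _ _ (envSigma X Y t) _ _ fun s => ?_
    exact (comap_measurable (X s)).mono
      ((le_iSup (fun s => MeasurableSpace.comap (X s) inferInstance) s).trans le_sup_left) le_rfl
  · refine @measurable_pi_lambda _ _ _ (envSigma X Y t) _ _ fun s => ?_
    by_cases hs : s < t
    · simp only [truncPath, hs, if_true]
      exact (comap_measurable (Y s)).mono
        ((le_iSup₂ (f := fun s (_ : s < t) => MeasurableSpace.comap (Y s) inferInstance) s hs).trans
          le_sup_right) le_rfl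
    · simp only [truncPath, hs, if_false]
      exact measurable_const

lemma envSigma_le {Ω E F : Type*} [MeasurableSpace Ω] {μ : Measure Ω} [MeasurableSpace E]
    [MeasurableSpace F] {P : Kernel (F × E) E} {X : ℤ → Ω → F} {Y : ℤ → Ω → E}
    (hchain : IsChainInRandomEnv μ P X Y) (t : ℤ) :
    envSigma X Y t ≤ ‹MeasurableSpace Ω› :=
  sup_le (iSup_le fun s => (hchain.measurable_env s).comap_le)
    (iSup₂_le fun s _ => (hchain.measurable_chain s).comap_le)

variable {Ω E F : Type*} [MeasurableSpace Ω] {μ : Measure Ω} [IsProbabilityMeasure μ]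
    [MeasurableSpace E] [MeasurableSpace F]
    {P : Kernel (F × E) E} [IsMarkovKernel P] {X : ℤ → Ω → F} {Y : ℤ → Ω → E}

/-- Integration of the `t`-th coordinate of the chain with respect to its transition kernel. -/
def integrateAt (P : Kernel (F × E) E) (t : ℤ) (Φ : (ℤ → F) → (ℤ → E) → ℝ≥0∞)
    (x : ℤ → F) (y : ℤ → E) : ℝ≥0∞ :=
  ∫⁻ y', Φ x (Function.update y t y') ∂(P (x (t - 1), y (t - 1)))

lemma measurable_update_prod (t : ℤ) {α : Type*} [MeasurableSpace α] {f : α → ℤ → E} {g : α → E}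
    (hf : Measurable f) (hg : Measurable g) :
    Measurable fun a => Function.update (f a) t (g a) := by
  refine measurable_pi_lambda _ fun s => ?_
  by_cases hs : s = t
  · subst hs; simpa using hg
  · simp only [Function.update_of_ne hs]
    exact (measurable_pi_apply s).comp hf

lemma measurable_integrateAt (t : ℤ) {Φ : (ℤ → F) → (ℤ → E) → ℝ≥0∞}
    (hΦ : Measurable (Function.uncurry Φ)) :
    Measurable (Function.uncurry (integrateAt P t Φ)) := by
  have hφ : Measurable fun p : (ℤ → F) × (ℤ → E) => (p.1 (t - 1), p.2 (t - 1)) := by fun_prop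
  have := Measurable.lintegral_kernel_prod_right (κ := P.comap _ hφ)
    (f := fun (p : (ℤ → F) × (ℤ → E)) y' => Φ p.1 (Function.update p.2 t y'))
    (hΦ.comp (f := fun q : ((ℤ → F) × (ℤ → E)) × E => (q.1.1, Function.update q.1.2 t q.2))
      (by
        have := measurable_update_prod t
          (f := fun q : ((ℤ → F) × (ℤ → E)) × E => q.1.2) (g := fun q => q.2)
          (by fun_prop) (by fun_prop)
        fun_prop))
  exact this

/-- Truncating the chain before `t` makes the pair of trajectories measurable for `envSigma X Y t`.
Its preimages are therefore admissible test events for the conditional probability, and rectangles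
determine the joint law. -/
lemma map_truncPath_prod_eq_compProd (hchain : IsChainInRandomEnv μ P X Y) (e : E) (t : ℤ)
    {φ : (ℤ → F) × (ℤ → E) → F × E} (hφm : Measurable φ)
    (hφ : φ = fun p => (p.1 (t - 1), p.2 (t - 1))) :
    μ.map (fun ω => (((fun s => X s ω), truncPath e t fun s => Y s ω), Y t ω)) =
      (μ.map fun ω => ((fun s => X s ω), truncPath e t fun s => Y s ω)) ⊗ₘ (P.comap φ hφm) := by
  have hπ' := measurable_envSigma_truncPath (X := X) (Y := Y) e t
  have hle := envSigma_le hchain t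
  have hπ := hπ'.mono hle le_rfl
  have hY := hchain.measurable_chain t
  have : IsProbabilityMeasure (μ.map fun ω => ((fun s => X s ω), truncPath e t fun s => Y s ω)) :=
    Measure.isProbabilityMeasure_map hπ.aemeasurable
  have : IsProbabilityMeasure
      (μ.map (fun ω => (((fun s => X s ω), truncPath e t fun s => Y s ω), Y t ω))) :=
    Measure.isProbabilityMeasure_map (hπ.prodMk hY).aemeasurable
  refine Measure.ext_prod fun {G A} hG hA => ?_
  have hκ : Measurable fun ω => P (X (t - 1) ω, Y (t - 1) ω) A :=
    (P.measurable_coe hA).comp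
      ((hchain.measurable_env _).prodMk (hchain.measurable_chain _))
  rw [Measure.map_apply (hπ.prodMk hY) (hG.prod hA), Measure.compProd_apply_prod hG hA,
    setLIntegral_map hG (Kernel.measurable_coe _ hA) hπ]
  set S := (fun ω => ((fun s => X s ω), truncPath e t fun s => Y s ω)) ⁻¹' G with hS
  have hSm : MeasurableSet[envSigma X Y t] S := hπ' hG
  have hval : ∀ ω, (P.comap φ hφm) ((fun s => X s ω), truncPath e t fun s => Y s ω) A =
      P (X (t - 1) ω, Y (t - 1) ω) A := by
    intro ω
    rw [Kernel.comap_apply, hφ]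
    simp [truncPath]
  simp_rw [hval]
  have hset : (fun ω => (((fun s => X s ω), truncPath e t fun s => Y s ω), Y t ω)) ⁻¹' (G ×ˢ A) =
      Y t ⁻¹' A ∩ S := by
    ext ω; simp [S, and_comm]
  rw [hset]
  have h1 : μ.real (Y t ⁻¹' A ∩ S) = ∫ ω in S, (P (X (t - 1) ω, Y (t - 1) ω)).real A ∂μ := by
    have hint : Integrable ((Y t ⁻¹' A).indicator fun _ => (1 : ℝ)) μ :=
      (integrable_const _).indicator (hY hA)
    have := setIntegral_condExp hle hint hSm
    rw [integral_indicator_const _ (hY hA), measureReal_restrict_apply (hY hA)] at this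
    rw [smul_eq_mul, mul_one] at this
    rw [← this]
    exact integral_congr_ae (ae_restrict_of_ae (hchain.condProb t A hA))
  have h2 : ∫ ω in S, (P (X (t - 1) ω, Y (t - 1) ω)).real A ∂μ =
      (∫⁻ ω in S, P (X (t - 1) ω, Y (t - 1) ω) A ∂μ).toReal :=
    integral_toReal hκ.aemeasurable (ae_of_all _ fun ω => measure_lt_top _ _)
  have hfin : ∫⁻ ω in S, P (X (t - 1) ω, Y (t - 1) ω) A ∂μ ≠ ∞ := by
    refine ne_top_of_le_ne_top ENNReal.one_ne_top ?_
    calc ∫⁻ ω in S, P (X (t - 1) ω, Y (t - 1) ω) A ∂μ ≤ ∫⁻ _ in S, 1 ∂μ :=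
          lintegral_mono fun _ => prob_le_one
      _ ≤ 1 := by simpa using prob_le_one
  exact (ENNReal.toReal_eq_toReal_iff' (measure_ne_top _ _) hfin).1 (h1.trans h2)

/-- This is the Markov property for functions instead of events. It follows from the disintegration
of the joint law, since `Φ` sees only the truncated path and `Y t`. -/
lemma lintegral_eq_lintegral_integrateAt (hchain : IsChainInRandomEnv μ P X Y) (t : ℤ)
    {Φ : (ℤ → F) → (ℤ → E) → ℝ≥0∞} (hΦ : Measurable (Function.uncurry Φ))
    (hdep : ∀ x, DependsOn (Φ x) (Set.Iic t)) :
    ∫⁻ ω, Φ (fun s => X s ω) (fun s => Y s ω) ∂μ =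
      ∫⁻ ω, integrateAt P t Φ (fun s => X s ω) (fun s => Y s ω) ∂μ := by
  obtain ⟨ω₀⟩ := nonempty_of_isProbabilityMeasure μ
  have hφm : Measurable fun p : (ℤ → F) × (ℤ → E) => (p.1 (t - 1), p.2 (t - 1)) := by fun_prop
  have hmap := map_truncPath_prod_eq_compProd hchain (Y 0 ω₀) t hφm rfl
  have hπ := (measurable_envSigma_truncPath (X := X) (Y := Y) (Y 0 ω₀) t).mono
    (envSigma_le hchain t) le_rfl
  have hY := hchain.measurable_chain t
  set e := Y 0 ω₀
  let Ψ : ((ℤ → F) × (ℤ → E)) × E → ℝ≥0∞ := fun q => Φ q.1.1 (Function.update q.1.2 t q.2)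
  have hΨ : Measurable Ψ := hΦ.comp
      (f := fun q : ((ℤ → F) × (ℤ → E)) × E => (q.1.1, Function.update q.1.2 t q.2)) (by
        have := measurable_update_prod t
          (f := fun q : ((ℤ → F) × (ℤ → E)) × E => q.1.2) (g := fun q => q.2)
          (by fun_prop) (by fun_prop)
        fun_prop)
  have hup : ∀ x (y : ℤ → E) y', Φ x (Function.update (truncPath e t y) t y') =
      Φ x (Function.update y t y') := by
    intro x y y'
    refine hdep x fun s hs => ?_
    by_cases hst : s = t
    · subst hst; simp
    · simp [Function.update_of_ne hst, truncPath, lt_of_le_of_ne hs hst]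
  calc ∫⁻ ω, Φ (fun s => X s ω) (fun s => Y s ω) ∂μ
      = ∫⁻ ω, Ψ (((fun s => X s ω), truncPath e t fun s => Y s ω), Y t ω) ∂μ := by
        refine lintegral_congr fun ω => ?_
        simp only [Ψ, hup]
        congr 1
        exact (Function.update_eq_self t _).symm
    _ = ∫⁻ q, Ψ q ∂(μ.map (fun ω =>
          (((fun s => X s ω), truncPath e t fun s => Y s ω), Y t ω))) :=
        (lintegral_map hΨ (hπ.prodMk hY)).symm
    _ = _ := by
        rw [hmap, Measure.lintegral_compProd hΨ, lintegral_map (hΨ.lintegral_kernel_prod_right') hπ]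
        refine lintegral_congr fun ω => ?_
        simp only [Ψ, hup, integrateAt, Kernel.comap_apply]
        simp [truncPath]

/-- A function of the environment and of finitely many coordinates of the chain can be replaced
by a function of the environment and of the first of these coordinates. -/
lemma exists_collapse (hchain : IsChainInRandomEnv μ P X Y) (a : ℤ) (k : ℕ) {S : Set ℤ}
    (hS : ∀ i : ℤ, a ≤ i → i < a + k → i ∈ S)
    {Φ : (ℤ → F) → (ℤ → E) → ℝ≥0∞} (hΦ : Measurable (Function.uncurry Φ))
    (hΦ1 : ∀ x y, Φ x y ≤ 1) (hΦS : ∀ y, DependsOn (fun x => Φ x y) S)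
    (hdep : ∀ x, DependsOn (Φ x) (Set.Icc a (a + k))) :
    ∃ g : (ℤ → F) → E → ℝ≥0∞, Measurable (Function.uncurry g) ∧ (∀ x y, g x y ≤ 1) ∧
      (∀ y, DependsOn (fun x => g x y) S) ∧
      ∀ U : (ℤ → F) → (ℤ → E) → ℝ≥0∞, Measurable (Function.uncurry U) →
        (∀ x, DependsOn (U x) (Set.Iic a)) →
        ∫⁻ ω, U (fun s => X s ω) (fun s => Y s ω) * Φ (fun s => X s ω) (fun s => Y s ω) ∂μ =
          ∫⁻ ω, U (fun s => X s ω) (fun s => Y s ω) * g (fun s => X s ω) (Y a ω) ∂μ := by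
  induction k generalizing Φ with
  | zero =>
    -- Only coordinate `a` matters when `k = 0`, so a constant path may be inserted.
    refine ⟨fun x y => Φ x fun _ => y, ?_, fun x y => hΦ1 _ _, fun y => hΦS _, ?_⟩
    · exact hΦ.comp (f := fun p : (ℤ → F) × E => (p.1, fun _ : ℤ => p.2)) (by fun_prop)
    · intro U _ _
      refine lintegral_congr fun ω => ?_
      congr 1
      refine hdep _ fun s hs => ?_
      have : s = a := by simpa using hs
      rw [this]
  | succ k ih =>
    -- The last coordinate is integrated out. The transition into time `a + k + 1` is driven by the
    -- environment at `a + k`, hence the strict bound `i < a + k` in `hS`.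
    have hdep' : ∀ x, DependsOn (integrateAt P (a + k + 1) Φ x) (Set.Icc a (a + k)) := by
      intro x y z hyz
      change ℤ → E at y z
      have h1 : y (a + k) = z (a + k) := hyz _ ⟨by omega, le_rfl⟩
      simp only [integrateAt, add_sub_cancel_right, h1]
      refine lintegral_congr fun y' => hdep x fun s hs => ?_
      by_cases hst : s = a + k + 1
      · subst hst; simp
      · simp only [Function.update_of_ne hst]
        exact hyz s ⟨hs.1, by have := hs.2; push_cast at this; omega⟩
    obtain ⟨g, hg, hg1, hgS, hgU⟩ := ih (Φ := integrateAt P (a + k + 1) Φ)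
      (fun i hi hi' => hS i hi (by push_cast; omega)) (measurable_integrateAt _ hΦ)
      (fun x y => (lintegral_mono fun _ => hΦ1 _ _).trans (by simp))
      (fun y x x' hx => by
        change ℤ → F at x x'
        have h1 : x (a + k) = x' (a + k) := hx _ (hS _ (by omega) (by push_cast; omega))
        simp only [integrateAt, add_sub_cancel_right, h1]
        exact lintegral_congr fun y' => hΦS _ hx)
      hdep'
    refine ⟨g, hg, hg1, hgS, fun U hU hUd => ?_⟩
    rw [← hgU U hU hUd, lintegral_eq_lintegral_integrateAt hchain (a + k + 1)
      (Φ := fun x y => U x y * Φ x y) (hU.mul hΦ)]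
    · refine lintegral_congr fun ω => ?_
      simp only [integrateAt]
      rw [← lintegral_const_mul]
      · refine lintegral_congr fun y' => ?_
        congr 1
        refine hUd _ fun s hs => ?_
        rw [Function.update_of_ne]
        have : s ≤ a := hs
        omega
      · exact hΦ.comp (measurable_const.prodMk (measurable_update_prod _ measurable_const
          measurable_id))
    · intro x y z hyz
      refine congrArg₂ _ ?_ ?_
      · exact hUd x fun s hs => hyz s (by have : s ≤ a := hs; simp only [Set.mem_Iic]; omega)
      · exact hdep x fun s hs => hyz s (by
          have := hs.2; push_cast at this; simp only [Set.mem_Iic]; omega)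

/-- The state at `c + N` is pulled back to time `c` one transition at a time; `U` is untouched
because it sees the chain only up to `c`. -/
lemma lintegral_mul_eq_lintegral_mul_iterOp (hchain : IsChainInRandomEnv μ P X Y) (c : ℤ) (N : ℕ)
    {g : (ℤ → F) → E → ℝ≥0∞} (hg : Measurable (Function.uncurry g))
    {U : (ℤ → F) → (ℤ → E) → ℝ≥0∞} (hU : Measurable (Function.uncurry U))
    (hUd : ∀ x, DependsOn (U x) (Set.Iic c)) :
    ∫⁻ ω, U (fun s => X s ω) (fun s => Y s ω) * g (fun s => X s ω) (Y (c + N) ω) ∂μ =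
      ∫⁻ ω, U (fun s => X s ω) (fun s => Y s ω) * iterOp P c N g (fun s => X s ω) (Y c ω) ∂μ := by
  induction N generalizing c with
  | zero => simp [iterOp]
  | succ N ih =>
    have hit := measurable_iterOp (P := P) (c + 1) N hg
    have := ih (c + 1) fun x => (hUd x).mono (Set.Iic_subset_Iic.2 (by omega))
    rw [show c + ((N + 1 : ℕ) : ℤ) = c + 1 + N by push_cast; ring, this,
      lintegral_eq_lintegral_integrateAt hchain (c + 1)
        (Φ := fun x y => U x y * iterOp P (c + 1) N g x (y (c + 1)))]
    · refine lintegral_congr fun ω => ?_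
      simp only [integrateAt, iterOp, stepOp, Function.update_self, add_sub_cancel_right]
      rw [← lintegral_const_mul _ (f := iterOp P (c + 1) N g fun s => X s ω)
        (hit.comp measurable_prodMk_left)]
      refine lintegral_congr fun y' => ?_
      congr 1
      refine hUd _ fun s hs => ?_
      rw [Function.update_of_ne]
      have : s ≤ c := hs
      omega
    · exact hU.mul (hit.comp (f := fun p : (ℤ → F) × (ℤ → E) => (p.1, p.2 (c + 1)))
        (by fun_prop))
    · intro x y z hyz
      refine congrArg₂ _ ?_ (by rw [hyz (c + 1) (by simp)])
      exact hUd x fun s hs => hyz s (by have : s ≤ c := hs; simp only [Set.mem_Iic]; omega)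

end Markov

/-! ### Forgetting of the initial state -/

section Forgetting

variable {Ω E F : Type*} [MeasurableSpace Ω] {μ : Measure Ω} [IsProbabilityMeasure μ]
    [TopologicalSpace E] [PolishSpace E] [MeasurableSpace E] [BorelSpace E]
    [TopologicalSpace F] [PolishSpace F] [MeasurableSpace F] [BorelSpace F]
    {P : Kernel (F × E) E} [IsMarkovKernel P] {X : ℤ → Ω → F} {Y : ℤ → Ω → E} {m : ℕ}
    {η : (Fin m → F) → ℝ} {ν : (Fin m → F) → Measure E}

/-- Forgetting of the initial state: a function of the environment on `S` and of the chain on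
`[c + N, c + N + k]` is replaced by a function of the environment on `S` alone, up to the expected
contraction coefficient between the times `c` and `c + N`. -/
lemma exists_env_approx (hchain : IsChainInRandomEnv μ P X Y) (hstat : IsStationary μ X)
    (hD : IsDoeblin μ P X m η ν) (c : ℤ) (N k : ℕ) {S : Set ℤ}
    (hS : ∀ i : ℤ, c ≤ i → i < c + N + k → i ∈ S)
    {Φ : (ℤ → F) → (ℤ → E) → ℝ≥0∞} (hΦ : Measurable (Function.uncurry Φ))
    (hΦ1 : ∀ x y, Φ x y ≤ 1) (hΦS : ∀ y, DependsOn (fun x => Φ x y) S)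
    (hdep : ∀ x, DependsOn (Φ x) (Set.Icc (c + N) (c + N + k))) :
    ∃ f : (ℤ → F) → ℝ≥0∞, Measurable f ∧ (∀ x, f x ≤ 1) ∧ DependsOn f S ∧
      ∀ U : (ℤ → F) → (ℤ → E) → ℝ≥0∞, Measurable (Function.uncurry U) → (∀ x y, U x y ≤ 1) →
        (∀ x, DependsOn (U x) (Set.Iic c)) →
        ∫⁻ ω, U (fun s => X s ω) (fun s => Y s ω) * Φ (fun s => X s ω) (fun s => Y s ω) ∂μ ≤
          ∫⁻ ω, U (fun s => X s ω) (fun s => Y s ω) * f (fun s => X s ω) ∂μ +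
            ∫⁻ x, ENNReal.ofReal (contraction η c (N / m) x) ∂(pathLaw μ X) ∧
        ∫⁻ ω, U (fun s => X s ω) (fun s => Y s ω) * f (fun s => X s ω) ∂μ ≤
          ∫⁻ ω, U (fun s => X s ω) (fun s => Y s ω) * Φ (fun s => X s ω) (fun s => Y s ω) ∂μ +
            ∫⁻ x, ENNReal.ofReal (contraction η c (N / m) x) ∂(pathLaw μ X) := by
  obtain ⟨ω₀⟩ := nonempty_of_isProbabilityMeasure μ
  have hXm : Measurable fun ω t => X t ω := measurable_pi_lambda _ hchain.measurable_env
  obtain ⟨g, hg, hg1, hgS, hgU⟩ := exists_collapse hchain (c + N) k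
    (fun i hi => hS i (by omega)) hΦ hΦ1 hΦS hdep
  have hit := measurable_iterOp (P := P) c N hg
  -- The state at time `c` is replaced by a reference state. Any state would do, as the oscillation
  -- bound is uniform in both states.
  refine ⟨fun x => iterOp P c N g x (Y 0 ω₀), hit.comp measurable_prodMk_right,
    fun x => iterOp_le_one _ _ hg1 _ _,
    DependsOn.iterOp hgS c N (fun i hi hi' => hS i hi (by omega)) _, fun U hU hU1 hUd => ?_⟩
  rw [hgU U hU fun x => (hUd x).mono (Set.Iic_subset_Iic.2 (by omega)),
    lintegral_mul_eq_lintegral_mul_iterOp hchain c N hg hU hUd]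
  have hosc := ae_of_ae_map hXm.aemeasurable
    (ae_iterOp_le hchain.measurable_env hstat hD c N hg hg1)
  have hcm := (measurable_contraction hD.measurable_eta c (N / m)).ennreal_ofReal
  have hD' : ∫⁻ x, ENNReal.ofReal (contraction η c (N / m) x) ∂(pathLaw μ X) =
      ∫⁻ ω, ENNReal.ofReal (contraction η c (N / m) fun s => X s ω) ∂μ := lintegral_map hcm hXm
  have hcm' : Measurable fun ω => ENNReal.ofReal (contraction η c (N / m) fun s => X s ω) :=
    hcm.comp hXm
  have hbound : ∀ u p q d : ℝ≥0∞, u ≤ 1 → p ≤ q + d → u * p ≤ u * q + d := by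
    intro u p q d hu hpq
    calc u * p ≤ u * (q + d) := by gcongr
      _ ≤ u * q + 1 * d := by rw [mul_add]; gcongr
      _ = _ := by rw [one_mul]
  rw [hD']
  constructor
  · rw [← lintegral_add_right _ hcm']
    refine lintegral_mono_ae ?_
    filter_upwards [hosc] with ω hω
    exact hbound _ _ _ _ (hU1 _ _) (hω _ _)
  · rw [← lintegral_add_right _ hcm']
    refine lintegral_mono_ae ?_
    filter_upwards [hosc] with ω hω
    exact hbound _ _ _ _ (hU1 _ _) (hω _ _)

end Forgetting

/-! ### Covariance inequalities for strong mixing coefficients -/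

section Alpha

variable {Ω : Type*} {𝓕 𝓖 : MeasurableSpace Ω} [m₀ : MeasurableSpace Ω] {μ : Measure Ω}
    [IsProbabilityMeasure μ]

lemma abs_measureReal_inter_sub_le_one (A B : Set Ω) :
    |μ.real (A ∩ B) - μ.real A * μ.real B| ≤ 1 := by
  have h1 : μ.real (A ∩ B) ≤ 1 := measureReal_le_one
  have h2 : μ.real A * μ.real B ≤ 1 :=
    mul_le_one₀ measureReal_le_one measureReal_nonneg measureReal_le_one
  have h3 : 0 ≤ μ.real A * μ.real B := by positivity
  have h4 : 0 ≤ μ.real (A ∩ B) := measureReal_nonneg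
  rw [abs_le]
  constructor <;> linarith

lemma abs_le_alphaCoeff {A B : Set Ω} (hA : MeasurableSet[𝓕] A) (hB : MeasurableSet[𝓖] B) :
    |μ.real (A ∩ B) - μ.real A * μ.real B| ≤ alphaCoeff μ 𝓕 𝓖 :=
  le_csSup ⟨1, by rintro _ ⟨A, B, -, -, rfl⟩; exact abs_measureReal_inter_sub_le_one A B⟩
    ⟨A, B, hA, hB, rfl⟩

lemma alphaCoeff_nonneg : 0 ≤ alphaCoeff μ 𝓕 𝓖 :=
  (abs_nonneg _).trans (abs_le_alphaCoeff (A := ∅) (B := ∅) (@MeasurableSet.empty _ 𝓕)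
    (@MeasurableSet.empty _ 𝓖))

lemma alphaCoeff_le {Ω : Type*} {𝓕 𝓖 : MeasurableSpace Ω} [MeasurableSpace Ω]
    {μ : Measure Ω} {b : ℝ} (h : ∀ A B, MeasurableSet[𝓕] A → MeasurableSet[𝓖] B →
    |μ.real (A ∩ B) - μ.real A * μ.real B| ≤ b) : alphaCoeff μ 𝓕 𝓖 ≤ b :=
  csSup_le ⟨_, ∅, ∅, @MeasurableSet.empty _ 𝓕, @MeasurableSet.empty _ 𝓖, rfl⟩
    (by rintro _ ⟨A, B, hA, hB, rfl⟩; exact h A B hA hB)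

lemma integrable_of_mem_unitInterval {u : Ω → ℝ} (hu : Measurable u) (h0 : ∀ ω, 0 ≤ u ω)
    (h1 : ∀ ω, u ω ≤ 1) : Integrable u μ :=
  Integrable.of_bound hu.aestronglyMeasurable 1 (ae_of_all _ fun ω => by
    rw [Real.norm_eq_abs, abs_of_nonneg (h0 ω)]; exact h1 ω)

/-- Among `[0, 1]`-valued `𝓕`-measurable functions `f`, the integral of `f * h` is bounded by the
one for an indicator function. -/
lemma exists_setIntegral_ge (h𝓕 : 𝓕 ≤ m₀) {f h : Ω → ℝ} (hf : Measurable[𝓕] f)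
    (hf0 : ∀ ω, 0 ≤ f ω) (hf1 : ∀ ω, f ω ≤ 1) (hh : Integrable h μ) :
    ∃ A, MeasurableSet[𝓕] A ∧ ∫ ω, f ω * h ω ∂μ ≤ ∫ ω in A, h ω ∂μ := by
  have hem : Measurable[𝓕] (μ[h | 𝓕]) := stronglyMeasurable_condExp.measurable
  -- The integral is largest when `f` is 1 where the conditional expectation of `h` is positive and
  -- 0 elsewhere.
  have hA : MeasurableSet[𝓕] {ω | 0 < (μ[h | 𝓕]) ω} :=
    hem measurableSet_Ioi
  have hbd : ∀ ω, ‖f ω‖ ≤ 1 := fun ω => by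
    rw [Real.norm_eq_abs, abs_le]; constructor <;> linarith [hf0 ω, hf1 ω]
  have hfh : Integrable (f * h) μ :=
    hh.bdd_mul (hf.mono h𝓕 le_rfl).aestronglyMeasurable (ae_of_all _ hbd)
  have hfe : Integrable (f * μ[h | 𝓕]) μ :=
    integrable_condExp.bdd_mul (hf.mono h𝓕 le_rfl).aestronglyMeasurable (ae_of_all _ hbd)
  refine ⟨_, hA, ?_⟩
  calc ∫ ω, f ω * h ω ∂μ = ∫ ω, (μ[f * h | 𝓕]) ω ∂μ := (integral_condExp h𝓕).symm
    _ = ∫ ω, (f * μ[h | 𝓕]) ω ∂μ :=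
        integral_congr_ae (condExp_mul_of_stronglyMeasurable_left hf.stronglyMeasurable hfh hh)
    _ ≤ ∫ ω, ({ω | 0 < (μ[h | 𝓕]) ω}.indicator (μ[h | 𝓕])) ω ∂μ := by
        refine integral_mono hfe (integrable_condExp.indicator (h𝓕 _ hA)) fun ω => ?_
        by_cases hω : 0 < (μ[h | 𝓕]) ω
        · rw [Set.indicator_of_mem (by exact hω)]
          exact mul_le_of_le_one_left hω.le (hf1 ω)
        · rw [Set.indicator_of_notMem (by exact hω)]
          exact mul_nonpos_of_nonneg_of_nonpos (hf0 ω) (not_lt.1 hω)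
    _ = ∫ ω in {ω | 0 < (μ[h | 𝓕]) ω}, (μ[h | 𝓕]) ω ∂μ := integral_indicator (h𝓕 _ hA)
    _ = _ := setIntegral_condExp h𝓕 hh hA

/-- The covariance is affine in each function, so `f` and then `g` can be replaced by indicators
without decreasing it. For `[0, 1]`-valued functions this gives the constant 1. -/
lemma integral_mul_sub_le_alphaCoeff (h𝓕 : 𝓕 ≤ m₀) (h𝓖 : 𝓖 ≤ m₀) {f g : Ω → ℝ}
    (hf : Measurable[𝓕] f) (hf0 : ∀ ω, 0 ≤ f ω) (hf1 : ∀ ω, f ω ≤ 1)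
    (hg : Measurable[𝓖] g) (hg0 : ∀ ω, 0 ≤ g ω) (hg1 : ∀ ω, g ω ≤ 1) :
    ∫ ω, f ω * g ω ∂μ - (∫ ω, f ω ∂μ) * ∫ ω, g ω ∂μ ≤ alphaCoeff μ 𝓕 𝓖 := by
  have hfm := hf.mono h𝓕 le_rfl
  have hgm := hg.mono h𝓖 le_rfl
  have hfi := integrable_of_mem_unitInterval (μ := μ) hfm hf0 hf1
  have hgi := integrable_of_mem_unitInterval (μ := μ) hgm hg0 hg1
  have hfgi : Integrable (fun ω => f ω * g ω) μ := integrable_of_mem_unitInterval (hfm.mul hgm) (fun ω => mul_nonneg (hf0 ω) (hg0 ω))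
    (fun ω => mul_le_one₀ (hf1 ω) (hg0 ω) (hg1 ω))
  obtain ⟨A, hA, hfA⟩ := exists_setIntegral_ge (μ := μ) h𝓕 hf hf0 hf1
    (h := fun ω => g ω - ∫ ω, g ω ∂μ) (hgi.sub (integrable_const _))
  have hA' := h𝓕 _ hA
  obtain ⟨B, hB, hgB⟩ := exists_setIntegral_ge (μ := μ) h𝓖 hg hg0 hg1
    (h := fun ω => A.indicator (fun _ => (1 : ℝ)) ω - μ.real A)
    (((integrable_const (1 : ℝ)).indicator hA').sub (integrable_const _))
  have hB' := h𝓖 _ hB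
  have e1 : ∫ ω, f ω * (g ω - ∫ ω, g ω ∂μ) ∂μ =
      ∫ ω, f ω * g ω ∂μ - (∫ ω, f ω ∂μ) * ∫ ω, g ω ∂μ := by
    simp only [mul_sub]
    rw [integral_sub hfgi (hfi.mul_const _), integral_mul_const]
  have e2 : ∫ ω in A, (g ω - ∫ ω, g ω ∂μ) ∂μ =
      ∫ ω in A, g ω ∂μ - μ.real A * ∫ ω, g ω ∂μ := by
    rw [integral_sub hgi.integrableOn (integrable_const _)]
    simp
  have e3 : ∫ ω, g ω * (A.indicator (fun _ => (1 : ℝ)) ω - μ.real A) ∂μ =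
      ∫ ω in A, g ω ∂μ - μ.real A * ∫ ω, g ω ∂μ := by
    have : (fun ω => g ω * (A.indicator (fun _ => (1 : ℝ)) ω - μ.real A)) =
        fun ω => A.indicator g ω - g ω * μ.real A := by
      ext ω
      by_cases hω : ω ∈ A <;> simp [hω, mul_sub]
    rw [this, integral_sub (hgi.indicator hA') (hgi.mul_const _), integral_mul_const,
      integral_indicator hA', mul_comm (μ.real A)]
  have e4 : ∫ ω in B, (A.indicator (fun _ => (1 : ℝ)) ω - μ.real A) ∂μ =
      μ.real (A ∩ B) - μ.real A * μ.real B := by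
    rw [integral_sub ((integrable_const (1 : ℝ)).indicator hA').integrableOn (integrable_const _),
      integral_indicator_const _ hA', measureReal_restrict_apply hA']
    simp [mul_comm]
  rw [e1, e2] at hfA
  rw [e3, e4] at hgB
  exact (hfA.trans hgB).trans ((le_abs_self _).trans (abs_le_alphaCoeff hA hB))

/-- Replacing `f` by `1 - f` reverses the sign of the covariance and supplies the other inequality.
-/
lemma abs_integral_mul_sub_le_alphaCoeff (h𝓕 : 𝓕 ≤ m₀) (h𝓖 : 𝓖 ≤ m₀) {f g : Ω → ℝ}
    (hf : Measurable[𝓕] f) (hf0 : ∀ ω, 0 ≤ f ω) (hf1 : ∀ ω, f ω ≤ 1)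
    (hg : Measurable[𝓖] g) (hg0 : ∀ ω, 0 ≤ g ω) (hg1 : ∀ ω, g ω ≤ 1) :
    |∫ ω, f ω * g ω ∂μ - (∫ ω, f ω ∂μ) * ∫ ω, g ω ∂μ| ≤ alphaCoeff μ 𝓕 𝓖 := by
  have hfm := hf.mono h𝓕 le_rfl
  have hgm := hg.mono h𝓖 le_rfl
  have hfi := integrable_of_mem_unitInterval (μ := μ) hfm hf0 hf1
  have hgi := integrable_of_mem_unitInterval (μ := μ) hgm hg0 hg1
  have hfgi : Integrable (fun ω => f ω * g ω) μ := integrable_of_mem_unitInterval (hfm.mul hgm) (fun ω => mul_nonneg (hf0 ω) (hg0 ω))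
    (fun ω => mul_le_one₀ (hf1 ω) (hg0 ω) (hg1 ω))
  have h1 := integral_mul_sub_le_alphaCoeff (μ := μ) h𝓕 h𝓖 hf hf0 hf1 hg hg0 hg1
  have h2 := integral_mul_sub_le_alphaCoeff (μ := μ) h𝓕 h𝓖 (f := fun ω => 1 - f ω)
    (Measurable.sub (m := 𝓕) measurable_const hf) (fun ω => sub_nonneg.2 (hf1 ω))
    (fun ω => sub_le_self _ (hf0 ω)) hg hg0 hg1
  simp only [sub_mul, one_mul] at h2
  rw [integral_sub hgi hfgi, integral_sub (integrable_const _) hfi] at h2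
  simp only [integral_const, probReal_univ, smul_eq_mul, mul_one, sub_mul, one_mul] at h2
  rw [abs_le]
  constructor <;> linarith

end Alpha

/-! ### Functions of the trajectory of a stationary mixing process -/

section Path

variable {Ω F : Type*} [MeasurableSpace Ω] {μ : Measure Ω} [IsProbabilityMeasure μ]
    [MeasurableSpace F] {X : ℤ → Ω → F}

lemma measurable_comp_of_dependsOn {Ω F β : Type*} [MeasurableSpace F] [MeasurableSpace β]
    [Nonempty Ω] {X : ℤ → Ω → F} {𝓕 : MeasurableSpace Ω} {S : Set ℤ}
    (hX : ∀ j ∈ S, Measurable[𝓕] (X j)) {f : (ℤ → F) → β} (hf : Measurable f)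
    (hd : DependsOn f S) : Measurable[𝓕] fun ω => f fun t => X t ω := by
  classical
  obtain ⟨ω₀⟩ := ‹Nonempty Ω›
  -- Coordinates outside `S` are frozen at a fixed `ω₀`; what remains is measurable for `𝓕`.
  have h1 : (fun ω => f fun t => X t ω) = fun ω => f fun t => if t ∈ S then X t ω else X t ω₀ := by
    ext ω
    exact hd fun t ht => by simp [ht]
  rw [h1]
  refine hf.comp (@measurable_pi_lambda _ _ _ 𝓕 _ _ fun t => ?_)
  by_cases ht : t ∈ S
  · simpa only [ht, if_true] using hX t ht
  · simp only [ht, if_false]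
    exact measurable_const

lemma pastSigma_le (hX : ∀ t, Measurable (X t)) (k : ℤ) : pastSigma X k ≤ ‹MeasurableSpace Ω› :=
  iSup₂_le fun j _ => (hX j).comap_le

lemma futureSigma_le (hX : ∀ t, Measurable (X t)) (k : ℤ) :
    futureSigma X k ≤ ‹MeasurableSpace Ω› :=
  iSup₂_le fun j _ => (hX j).comap_le

lemma measurable_pastSigma {Ω F : Type*} [MeasurableSpace F] {X : ℤ → Ω → F} {k j : ℤ} (hj : j ≤ k) : Measurable[pastSigma X k] (X j) :=
  (comap_measurable (X j)).mono
    (le_iSup₂ (f := fun j (_ : j ≤ k) => MeasurableSpace.comap (X j) inferInstance) j hj) le_rfl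

lemma measurable_futureSigma {Ω F : Type*} [MeasurableSpace F] {X : ℤ → Ω → F} {k j : ℤ} (hj : k ≤ j) : Measurable[futureSigma X k] (X j) :=
  (comap_measurable (X j)).mono
    (le_iSup₂ (f := fun j (_ : k ≤ j) => MeasurableSpace.comap (X j) inferInstance) j hj) le_rfl

lemma isProbabilityMeasure_pathLaw (hX : ∀ t, Measurable (X t)) :
    IsProbabilityMeasure (pathLaw μ X) :=
  Measure.isProbabilityMeasure_map (measurable_pi_lambda _ hX).aemeasurable

lemma alphaMix_nonneg (n : ℕ) : 0 ≤ alphaMix μ X n := alphaCoeff_nonneg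

lemma dependsOn_comp_shiftPath {F β : Type*} {f : (ℤ → F) → β} {S T : Set ℤ} (hf : DependsOn f S)
    (k : ℤ) (hST : ∀ t ∈ S, t + k ∈ T) : DependsOn (fun x => f (shiftPath k x)) T :=
  fun _ _ hxy => hf fun t ht => hxy (t + k) (hST t ht)

/-- Covariance inequality for functions of the past and of the future of the trajectory. -/
lemma abs_integral_mul_sub_le_alphaMix (hX : ∀ t, Measurable (X t)) (hstat : IsStationary μ X)
    (a : ℤ) (n : ℕ) {f g : (ℤ → F) → ℝ}
    (hf : Measurable f) (hf0 : ∀ x, 0 ≤ f x) (hf1 : ∀ x, f x ≤ 1) (hfd : DependsOn f (Set.Iic a))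
    (hg : Measurable g) (hg0 : ∀ x, 0 ≤ g x) (hg1 : ∀ x, g x ≤ 1)
    (hgd : DependsOn g (Set.Ici (a + n))) :
    |∫ x, f x * g x ∂(pathLaw μ X) - (∫ x, f x ∂(pathLaw μ X)) * ∫ x, g x ∂(pathLaw μ X)| ≤
      alphaMix μ X n := by
  have hne := nonempty_of_isProbabilityMeasure μ
  have hXm : Measurable fun ω t => X t ω := measurable_pi_lambda _ hX
  have hshift : ∀ u : (ℤ → F) → ℝ, Measurable u →
      ∫ x, u x ∂(pathLaw μ X) = ∫ ω, u (shiftPath (-a) fun t => X t ω) ∂μ := by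
    intro u hu
    have hmp := measurePreserving_shiftPath hX hstat (-a)
    conv_lhs => rw [← hmp.map_eq]
    rw [integral_map (by fun_prop) hu.aestronglyMeasurable, pathLaw,
      integral_map (f := fun x => u (shiftPath (-a) x)) hXm.aemeasurable
        (hu.comp (measurable_shiftPath _)).aestronglyMeasurable]
  rw [hshift f hf, hshift g hg, hshift (fun x => f x * g x) (hf.mul hg)]
  refine abs_integral_mul_sub_le_alphaCoeff (f := fun ω => f (shiftPath (-a) fun t => X t ω))
    (g := fun ω => g (shiftPath (-a) fun t => X t ω)) (pastSigma_le hX 0) (futureSigma_le hX n) ?_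
    (fun _ => hf0 _) (fun _ => hf1 _) ?_ (fun _ => hg0 _) (fun _ => hg1 _)
  · exact measurable_comp_of_dependsOn (S := Set.Iic 0) (fun j hj => measurable_pastSigma hj)
      (f := fun x => f (shiftPath (-a) x)) (hf.comp (measurable_shiftPath (-a)))
      (dependsOn_comp_shiftPath hfd (-a) fun t ht => by simp at ht ⊢; omega)
  · exact measurable_comp_of_dependsOn (S := Set.Ici (n : ℤ))
      (fun j hj => measurable_futureSigma hj)
      (f := fun x => g (shiftPath (-a) x)) (hg.comp (measurable_shiftPath (-a)))
      (dependsOn_comp_shiftPath hgd (-a) fun t ht => by simp at ht ⊢; omega)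

end Path

/-! ### Expected contraction coefficients -/

section Expected

variable {Ω F : Type*} [MeasurableSpace Ω] {μ : Measure Ω} [IsProbabilityMeasure μ]
    [MeasurableSpace F] {X : ℤ → Ω → F} {m : ℕ} {η : (Fin m → F) → ℝ}

lemma dependsOn_pathBlock {F β : Type*} {m : ℕ} (φ : (Fin m → F) → β) (c : ℤ) {S : Set ℤ}
    (hS : ∀ t, c ≤ t → t < c + m → t ∈ S) :
    DependsOn (fun x : ℤ → F => φ (pathBlock m c x)) S := by
  intro x x' h
  refine congrArg φ (funext fun i => ?_)
  exact h _ (hS _ (by omega) (by have := i.2; omega))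

lemma integral_pathBlock {Ω F : Type*} [MeasurableSpace Ω] {μ : Measure Ω}
    [MeasurableSpace F] {X : ℤ → Ω → F} {m : ℕ} {η : (Fin m → F) → ℝ} (hX : ∀ t, Measurable (X t)) (hstat : IsStationary μ X)
    (hη : Measurable η) (c : ℤ) :
    ∫ x, η (pathBlock m c x) ∂(pathLaw μ X) = ∫ ω, η (envBlock X m 0 ω) ∂μ := by
  have hXm : Measurable fun ω t => X t ω := measurable_pi_lambda _ hX
  have h0 : ∫ x, η (pathBlock m 0 x) ∂(pathLaw μ X) = ∫ ω, η (envBlock X m 0 ω) ∂μ :=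
    integral_map hXm.aemeasurable
      (f := fun x => η (pathBlock m 0 x)) (Measurable.aestronglyMeasurable (by fun_prop))
  rw [← h0]
  have hmp := measurePreserving_shiftPath hX hstat c
  conv_rhs => rw [← hmp.map_eq]
  rw [integral_map (by fun_prop) (Measurable.aestronglyMeasurable (by fun_prop))]
  refine integral_congr_ae (ae_of_all _ fun x => ?_)
  refine congrArg η (funext fun i => ?_)
  simp only [pathBlock, shiftPath]
  congr 1
  ring

lemma rho_mem_Ioo (hX : ∀ t, Measurable (X t)) (hη : Measurable η)
    (hη01 : ∀ z, η z ∈ Set.Ioo (0 : ℝ) 1) :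
    1 - ∫ ω, η (envBlock X m 0 ω) ∂μ ∈ Set.Ioo (0 : ℝ) 1 := by
  have hm : Measurable fun ω => η (envBlock X m 0 ω) :=
    hη.comp (measurable_pi_lambda _ fun i => hX _)
  have hi : Integrable (fun ω => η (envBlock X m 0 ω)) μ :=
    Integrable.of_bound hm.aestronglyMeasurable 1 (ae_of_all _ fun ω => by
      rw [Real.norm_eq_abs, abs_of_pos (hη01 _).1]; exact (hη01 _).2.le)
  have hpos : ∀ u : Ω → ℝ, Integrable u μ → (∀ ω, 0 < u ω) → 0 < ∫ ω, u ω ∂μ := by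
    intro u hu h0
    rw [integral_pos_iff_support_of_nonneg (fun ω => (h0 ω).le) hu]
    have : Function.support u = Set.univ := by
      ext ω; simp [(h0 ω).ne']
    simp [this]
  have h1 := hpos _ hi fun ω => (hη01 _).1
  have h2 := hpos _ ((integrable_const (1 : ℝ)).sub hi) fun ω => sub_pos.2 (hη01 _).2
  have e : ∫ ω, ((fun _ : Ω => (1 : ℝ)) - fun ω : Ω => η (envBlock X m 0 ω)) ω ∂μ =
      1 - ∫ ω, η (envBlock X m 0 ω) ∂μ := by
    simp only [Pi.sub_apply]
    rw [integral_sub (integrable_const _) hi]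
    simp
  rw [e] at h2
  exact ⟨h2, by linarith⟩

/-- Expected product of the contraction coefficients of `k` blocks, every two consecutive ones of
them separated by `(j - 1) * m + 1` time units. -/
lemma integral_prod_blocks_le (hX : ∀ t, Measurable (X t)) (hstat : IsStationary μ X)
    (hη : Measurable η) (hη01 : ∀ z, η z ∈ Set.Ioo (0 : ℝ) 1) {ρ : ℝ}
    (hρ : ρ = 1 - ∫ ω, η (envBlock X m 0 ω) ∂μ) (c : ℤ) {j : ℕ} (hj : 1 ≤ j) (k : ℕ) :
    ∫ x, ∏ i ∈ Finset.range k, (1 - η (pathBlock m (c + (i * j : ℕ) * m) x)) ∂(pathLaw μ X) ≤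
      ρ ^ k + alphaMix μ X ((j - 1) * m + 1) / (1 - ρ) := by
  have hprob := isProbabilityMeasure_pathLaw (μ := μ) hX
  have hρ01 := rho_mem_Ioo (μ := μ) hX hη hη01
  rw [← hρ] at hρ01
  set α := alphaMix μ X ((j - 1) * m + 1) with hα
  have hα0 : 0 ≤ α := alphaMix_nonneg _
  have h1ρ : 0 < 1 - ρ := sub_pos.2 hρ01.2
  have hW : ∀ c, ∫ x, (1 - η (pathBlock m c x)) ∂(pathLaw μ X) = ρ := by
    intro c
    have hi : Integrable (fun x => η (pathBlock m c x)) (pathLaw μ X) :=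
      Integrable.of_bound (Measurable.aestronglyMeasurable (by fun_prop)) 1 (ae_of_all _ fun ω => by
        rw [Real.norm_eq_abs, abs_of_pos (hη01 _).1]; exact (hη01 _).2.le)
    rw [integral_sub (integrable_const _) hi, integral_pathBlock hX hstat hη, hρ]
    simp
  induction k with
  | zero => simpa using div_nonneg hα0 h1ρ.le
  | succ k ih =>
    -- Block `k - 1` ends at `c + (k - 1) j m + m - 1` and block `k` starts at `c + k j m`. The gap
    -- is `(j - 1) m + 1`.
    have hcov := abs_integral_mul_sub_le_alphaMix hX hstat
      (c + (k * j : ℕ) * m - ((j - 1) * m + 1 : ℕ)) ((j - 1) * m + 1)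
      (f := fun x => ∏ i ∈ Finset.range k, (1 - η (pathBlock m (c + (i * j : ℕ) * m) x)))
      (g := fun x => 1 - η (pathBlock m (c + (k * j : ℕ) * m) x))
      (by fun_prop)
      (fun x => Finset.prod_nonneg fun _ _ => sub_nonneg.2 (hη01 _).2.le)
      (fun x => Finset.prod_le_one (fun _ _ => sub_nonneg.2 (hη01 _).2.le) fun _ _ =>
        sub_le_self _ (hη01 _).1.le)
      (by
        intro x x' hx
        refine Finset.prod_congr rfl fun i hi => ?_
        refine dependsOn_pathBlock (fun z => 1 - η z) _ (fun t ht ht' => ?_) hx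
        have hik : i + 1 ≤ k := Finset.mem_range.1 hi
        obtain ⟨j, rfl⟩ := Nat.exists_eq_add_of_le' hj
        have : ((i + 1) * ((j + 1) * m) : ℤ) ≤ k * ((j + 1) * m) := by
          exact_mod_cast Nat.mul_le_mul_right _ hik
        simp only [Set.mem_Iic, Nat.add_sub_cancel]
        push_cast at *
        linarith)
      (by fun_prop) (fun x => sub_nonneg.2 (hη01 _).2.le) (fun x => sub_le_self _ (hη01 _).1.le)
      (by
        refine dependsOn_pathBlock (fun z => 1 - η z) _ (fun t ht ht' => ?_)
        simp only [Set.mem_Ici, sub_add_cancel]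
        exact ht)
    rw [hW] at hcov
    simp only [Finset.prod_range_succ]
    have h1 := (le_abs_self _).trans hcov
    have h2 := mul_le_mul_of_nonneg_right ih hρ01.1.le
    -- `α / (1 - ρ)` is the fixed point of `x ↦ ρ x + α`, so the errors do not accumulate with `k`.
    have h3 : (ρ ^ k + α / (1 - ρ)) * ρ + α = ρ ^ (k + 1) + α / (1 - ρ) := by
      field_simp
      ring
    linarith

/-- All factors lie in `[0, 1]`, so dropping the blocks whose index is not a retained multiple of
`j` only increases the product. -/
lemma contraction_le_prod {F : Type*} {m : ℕ} {η : (Fin m → F) → ℝ}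
    (hη01 : ∀ z, η z ∈ Set.Ioo (0 : ℝ) 1) (c : ℤ) (s : ℕ) {j : ℕ} (hj : 1 ≤ j) (x : ℤ → F) :
    contraction η c s x ≤
      ∏ i ∈ Finset.range (s / j), (1 - η (pathBlock m (c + (i * j : ℕ) * m) x)) := by
  have hinj : Set.InjOn (fun i : ℕ => i * j) (Finset.range (s / j)) := fun a _ b _ h =>
    Nat.eq_of_mul_eq_mul_right hj h
  have hsub : (Finset.range (s / j)).image (fun i => i * j) ⊆ Finset.range s := by
    intro i hi
    obtain ⟨a, ha, rfl⟩ := Finset.mem_image.1 hi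
    have h1 : a + 1 ≤ s / j := Finset.mem_range.1 ha
    have h2 := (Nat.le_div_iff_mul_le hj).1 h1
    exact Finset.mem_range.2 (lt_of_lt_of_le (Nat.mul_lt_mul_of_pos_right (Nat.lt_succ_self a) hj)
      h2)
  have hnn : ∀ i : ℕ, 0 ≤ 1 - η (pathBlock m (c + i * m) x) := fun i =>
    sub_nonneg.2 (hη01 _).2.le
  rw [contraction, ← Finset.prod_sdiff hsub, Finset.prod_image hinj]
  exact mul_le_of_le_one_left (Finset.prod_nonneg fun i _ => hnn _)
    (Finset.prod_le_one (fun i _ => hnn _) fun i _ => sub_le_self _ (hη01 _).1.le)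

lemma integrable_contraction (hX : ∀ t, Measurable (X t))
    (hη : Measurable η) (hη01 : ∀ z, η z ∈ Set.Ioo (0 : ℝ) 1) (c : ℤ) (s : ℕ) :
    Integrable (contraction η c s) (pathLaw μ X) := by
  have hprob := isProbabilityMeasure_pathLaw (μ := μ) hX
  exact Integrable.of_bound (measurable_contraction hη c s).aestronglyMeasurable 1
    (ae_of_all _ fun x => by
      rw [Real.norm_eq_abs, abs_of_nonneg (contraction_nonneg hη01 c s x)]
      exact contraction_le_one hη01 c s x)

lemma integral_contraction_le (hX : ∀ t, Measurable (X t)) (hstat : IsStationary μ X)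
    (hη : Measurable η) (hη01 : ∀ z, η z ∈ Set.Ioo (0 : ℝ) 1) {ρ : ℝ}
    (hρ : ρ = 1 - ∫ ω, η (envBlock X m 0 ω) ∂μ) (c : ℤ) (s : ℕ) {j : ℕ} (hj : 1 ≤ j) :
    ∫ x, contraction η c s x ∂(pathLaw μ X) ≤
      ρ ^ (s / j) + alphaMix μ X ((j - 1) * m + 1) / (1 - ρ) := by
  have hprob := isProbabilityMeasure_pathLaw (μ := μ) hX
  refine (integral_mono (integrable_contraction hX hη hη01 c s) ?_
    fun x => contraction_le_prod hη01 c s hj x).trans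
    (integral_prod_blocks_le hX hstat hη hη01 hρ c hj (s / j))
  refine Integrable.of_bound (Measurable.aestronglyMeasurable (by fun_prop)) 1
    (ae_of_all _ fun x => ?_)
  rw [Real.norm_eq_abs, abs_of_nonneg (Finset.prod_nonneg fun _ _ => sub_nonneg.2 (hη01 _).2.le)]
  exact Finset.prod_le_one (fun _ _ => sub_nonneg.2 (hη01 _).2.le) fun _ _ =>
    sub_le_self _ (hη01 _).1.le

/-- First `j` makes the mixing error small, then `k` makes `ρ ^ k` small. Uniformity in `c` allows
the chain to be started arbitrarily far in the past. -/
lemma exists_integral_contraction_le (hX : ∀ t, Measurable (X t)) (hstat : IsStationary μ X)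
    (hmix : IsStronglyMixing μ X) (hm : 0 < m)
    (hη : Measurable η) (hη01 : ∀ z, η z ∈ Set.Ioo (0 : ℝ) 1) {ε : ℝ} (hε : 0 < ε) :
    ∃ s, ∀ c, ∫ x, contraction η c s x ∂(pathLaw μ X) ≤ ε := by
  have hρ01 := rho_mem_Ioo (μ := μ) hX hη hη01
  set ρ := 1 - ∫ ω, η (envBlock X m 0 ω) ∂μ with hρ
  have h1ρ : 0 < 1 - ρ := sub_pos.2 hρ01.2
  have hidx : Tendsto (fun j : ℕ => j * m + 1) atTop atTop :=
    tendsto_atTop_mono (fun j => (Nat.le_mul_of_pos_right j hm).trans (Nat.le_succ _)) tendsto_id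
  obtain ⟨j, hj⟩ := ((Tendsto.comp hmix hidx).eventually
    (gt_mem_nhds (show 0 < ε / 2 * (1 - ρ) by positivity))).exists
  obtain ⟨k, hk⟩ := exists_pow_lt_of_lt_one (half_pos hε) hρ01.2
  refine ⟨k * (j + 1), fun c => ?_⟩
  have := integral_contraction_le hX hstat hη hη01 hρ c (k * (j + 1)) (j := j + 1) (by omega)
  rw [Nat.mul_div_cancel _ (Nat.succ_pos j), Nat.add_sub_cancel] at this
  have h2 : alphaMix μ X (j * m + 1) / (1 - ρ) ≤ ε / 2 := by
    rw [div_le_iff₀ h1ρ]; exact hj.le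
  linarith

end Expected

/-! ### Approximation by finite windows -/

section Window

open scoped symmDiff

/-- Events of the limit of an increasing sequence of sigma-algebras are approximated by events of
these sigma-algebras. -/
lemma exists_measureReal_symmDiff_le {Ω : Type*} [m₀ : MeasurableSpace Ω] {μ : Measure Ω}
    [IsFiniteMeasure μ] {𝓜 : ℕ → MeasurableSpace Ω} (hmono : Monotone 𝓜) (hle : ∀ k, 𝓜 k ≤ m₀)
    {A : Set Ω} (hA : MeasurableSet[⨆ k, 𝓜 k] A) {ε : ℝ} (hε : 0 < ε) :
    ∃ k A', MeasurableSet[𝓜 k] A' ∧ μ.real (A' ∆ A) ≤ ε := by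
  have hle' : ⨆ k, 𝓜 k ≤ m₀ := iSup_le hle
  have hgen : (⨆ k, 𝓜 k) = MeasurableSpace.generateFrom (⋃ k, {s | MeasurableSet[𝓜 k] s}) :=
    (MeasurableSpace.generateFrom_iUnion_measurableSet 𝓜).symm
  have hring : IsSetRing (⋃ k, {s | MeasurableSet[𝓜 k] s}) := by
    refine ⟨Set.mem_iUnion.2 ⟨0, @MeasurableSet.empty _ (𝓜 0)⟩, ?_, ?_⟩
    · intro s t hs ht
      obtain ⟨i, hi⟩ := Set.mem_iUnion.1 hs
      obtain ⟨j, hj⟩ := Set.mem_iUnion.1 ht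
      exact Set.mem_iUnion.2 ⟨max i j, (hmono (le_max_left i j) _ hi).union
        (hmono (le_max_right i j) _ hj)⟩
    · intro s t hs ht
      obtain ⟨i, hi⟩ := Set.mem_iUnion.1 hs
      obtain ⟨j, hj⟩ := Set.mem_iUnion.1 ht
      exact Set.mem_iUnion.2 ⟨max i j, (hmono (le_max_left i j) _ hi).diff
        (hmono (le_max_right i j) _ hj)⟩
  obtain ⟨A', hA', hlt⟩ := @exists_measure_symmDiff_lt_of_generateFrom_isSetRing Ω (⨆ k, 𝓜 k)
    (μ.trim hle') _ _ hring ⟨{Set.univ}, Set.countable_singleton _,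
      Set.singleton_subset_iff.2 (Set.mem_iUnion.2 ⟨0, @MeasurableSet.univ _ (𝓜 0)⟩), by simp⟩
    hgen A hA (ENNReal.ofReal ε) (ENNReal.ofReal_pos.2 hε)
  obtain ⟨k, hk⟩ := Set.mem_iUnion.1 hA'
  refine ⟨k, A', hk, ?_⟩
  rw [trim_measurableSet_eq hle' (MeasurableSet.symmDiff (le_iSup 𝓜 k _ hk) hA)] at hlt
  exact ENNReal.toReal_le_of_le_ofReal hε.le hlt.le

/-- The intersection and the product each change by at most `2 * ε`. -/
lemma abs_measureReal_inter_sub_le_of_approx {Ω : Type*} [MeasurableSpace Ω] {μ : Measure Ω}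
    [IsProbabilityMeasure μ] {A A' B B' : Set Ω} (hA : MeasurableSet A) (hA' : MeasurableSet A')
    (hB : MeasurableSet B) (hB' : MeasurableSet B') {ε b : ℝ}
    (hAA' : μ.real (A' ∆ A) ≤ ε) (hBB' : μ.real (B' ∆ B) ≤ ε)
    (h : |μ.real (A' ∩ B') - μ.real A' * μ.real B'| ≤ b) :
    |μ.real (A ∩ B) - μ.real A * μ.real B| ≤ b + 4 * ε := by
  have h1 := (abs_measureReal_sub_le_measureReal_symmDiff (μ := μ) hA'.nullMeasurableSet
    hA.nullMeasurableSet).trans hAA'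
  have h2 := (abs_measureReal_sub_le_measureReal_symmDiff (μ := μ) hB'.nullMeasurableSet
    hB.nullMeasurableSet).trans hBB'
  have hsub : (A' ∩ B') ∆ (A ∩ B) ⊆ (A' ∆ A) ∪ (B' ∆ B) := by
    intro ω hω
    simp only [Set.mem_symmDiff, Set.mem_inter_iff, Set.mem_union] at hω ⊢
    tauto
  have h3 := ((abs_measureReal_sub_le_measureReal_symmDiff (μ := μ)
    (hA'.inter hB').nullMeasurableSet (hA.inter hB).nullMeasurableSet).trans
      (measureReal_mono hsub)).trans (measureReal_union_le _ _)
  have a1 : μ.real A ≤ 1 := measureReal_le_one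
  have b1 : μ.real B' ≤ 1 := measureReal_le_one
  have a0 : 0 ≤ μ.real A := measureReal_nonneg
  have b0 : 0 ≤ μ.real B' := measureReal_nonneg
  have h4 : |μ.real A' * μ.real B' - μ.real A * μ.real B| ≤ 2 * ε := by
    have e : μ.real A' * μ.real B' - μ.real A * μ.real B =
        (μ.real A' - μ.real A) * μ.real B' + μ.real A * (μ.real B' - μ.real B) := by ring
    rw [e]
    refine (abs_add_le _ _).trans ?_
    rw [abs_mul, abs_mul, abs_of_nonneg a0, abs_of_nonneg b0]
    have := mul_le_mul h1 b1 b0 ((abs_nonneg _).trans h1)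
    have := mul_le_mul a1 h2 (abs_nonneg _) zero_le_one
    linarith
  rw [abs_le] at *
  constructor <;> linarith [h.1, h.2, h3.1, h3.2, h4.1, h4.2]

variable {Ω H : Type*} [MeasurableSpace Ω] [MeasurableSpace H]

/-- The sigma-algebra generated by the `V j`, `j ∈ S`. -/
@[reducible] def windowSigma {Ω H : Type*} [MeasurableSpace H] (V : ℤ → Ω → H) (S : Set ℤ) :
    MeasurableSpace Ω :=
  ⨆ (j : ℤ) (_ : j ∈ S), MeasurableSpace.comap (V j) inferInstance

lemma windowSigma_mono {Ω H : Type*} [MeasurableSpace H] (V : ℤ → Ω → H) :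
    Monotone (windowSigma V) :=
  fun _ _ hST => iSup₂_mono' fun j hj => ⟨j, hST hj, le_rfl⟩

lemma windowSigma_le {V : ℤ → Ω → H} (hV : ∀ t, Measurable (V t)) (S : Set ℤ) :
    windowSigma V S ≤ ‹MeasurableSpace Ω› :=
  iSup₂_le fun j _ => (hV j).comap_le

lemma windowSigma_le_iSup {Ω H : Type*} [MeasurableSpace H] {V : ℤ → Ω → H} {S : Set ℤ}
    {T : ℕ → Set ℤ} (hST : S ⊆ ⋃ k, T k) : windowSigma V S ≤ ⨆ k, windowSigma V (T k) := by
  refine iSup₂_le fun j hj => ?_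
  obtain ⟨k, hk⟩ := Set.mem_iUnion.1 (hST hj)
  exact (le_iSup₂ (f := fun j (_ : j ∈ T k) => MeasurableSpace.comap (V j) inferInstance)
    j hk).trans (le_iSup (fun k => windowSigma V (T k)) k)

/-- The mixing coefficient of a process is determined by events depending on finite windows. -/
lemma alphaMix_le_of_windows {μ : Measure Ω} [IsProbabilityMeasure μ] {V : ℤ → Ω → H}
    (hV : ∀ t, Measurable (V t)) (n : ℕ) {b : ℝ}
    (h : ∀ (K L : ℕ) (A B : Set Ω), MeasurableSet[windowSigma V (Set.Icc (-K) 0)] A →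
      MeasurableSet[windowSigma V (Set.Icc n (n + L))] B →
      |μ.real (A ∩ B) - μ.real A * μ.real B| ≤ b) : alphaMix μ V n ≤ b := by
  refine le_of_forall_pos_le_add fun ε hε => ?_
  refine alphaCoeff_le fun A B hA hB => ?_
  have hA₁ : MeasurableSet[⨆ K : ℕ, windowSigma V (Set.Icc (-(K : ℤ)) 0)] A :=
    windowSigma_le_iSup (S := Set.Iic 0) (fun j hj => Set.mem_iUnion.2
      ⟨(-j).toNat, by simp only [Set.mem_Icc, Set.mem_Iic] at *; omega⟩) A hA
  have hB₁ : MeasurableSet[⨆ L : ℕ, windowSigma V (Set.Icc (n : ℤ) (n + L))] B :=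
    windowSigma_le_iSup (S := Set.Ici (n : ℤ)) (fun j hj => Set.mem_iUnion.2
      ⟨(j - n).toNat, by simp only [Set.mem_Icc, Set.mem_Ici] at *; omega⟩) B hB
  obtain ⟨K, A', hA', hAA'⟩ := exists_measureReal_symmDiff_le (μ := μ)
    (fun a b hab => windowSigma_mono V (Set.Icc_subset_Icc_left (by omega)))
    (fun _ => windowSigma_le hV _) hA₁ (show 0 < ε / 4 by positivity)
  obtain ⟨L, B', hB', hBB'⟩ := exists_measureReal_symmDiff_le (μ := μ)
    (fun a b hab => windowSigma_mono V (Set.Icc_subset_Icc_right (by omega)))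
    (fun _ => windowSigma_le hV _) hB₁ (show 0 < ε / 4 by positivity)
  have := abs_measureReal_inter_sub_le_of_approx (pastSigma_le hV 0 _ hA)
    (windowSigma_le hV _ _ hA') (futureSigma_le hV n _ hB) (windowSigma_le hV _ _ hB') hAA' hBB'
    (h K L A' B' hA' hB')
  linarith

/-- An event of a window is a function of the trajectory depending on this window only. -/
lemma exists_indicator_eq_of_windowSigma {Ω E F : Type*} [Nonempty Ω] [MeasurableSpace E]
    [MeasurableSpace F] {X : ℤ → Ω → F} {Y : ℤ → Ω → E} {S : Set ℤ} {A : Set Ω}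
    (hA : MeasurableSet[windowSigma (fun t ω => (X t ω, Y t ω)) S] A) :
    ∃ Φ : (ℤ → F) → (ℤ → E) → ℝ, Measurable (Function.uncurry Φ) ∧ (∀ x y, 0 ≤ Φ x y) ∧
      (∀ x y, Φ x y ≤ 1) ∧ (∀ y, DependsOn (fun x => Φ x y) S) ∧ (∀ x, DependsOn (Φ x) S) ∧
      ∀ ω, Φ (fun t => X t ω) (fun t => Y t ω) = A.indicator (fun _ => 1) ω := by
  classical
  obtain ⟨ω₀⟩ := ‹Nonempty Ω›
  -- Resetting the coordinates outside `S` to a fixed value makes the dependence on `S` hold for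
  -- every path, not just almost surely.
  let τX : (ℤ → F) → ℤ → F := fun x t => if t ∈ S then x t else X 0 ω₀
  let τY : (ℤ → E) → ℤ → E := fun y t => if t ∈ S then y t else Y 0 ω₀
  have hτX : Measurable τX := measurable_pi_lambda _ fun t => by
    by_cases ht : t ∈ S
    · simpa only [τX, ht, if_true] using measurable_pi_apply t
    · simp only [τX, ht, if_false]; exact measurable_const
  have hτY : Measurable τY := measurable_pi_lambda _ fun t => by
    by_cases ht : t ∈ S
    · simpa only [τY, ht, if_true] using measurable_pi_apply t
    · simp only [τY, ht, if_false]; exact measurable_const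
  have hle : windowSigma (fun t ω => (X t ω, Y t ω)) S ≤ MeasurableSpace.comap
      (fun ω => (τX fun t => X t ω, τY fun t => Y t ω)) inferInstance := by
    refine iSup₂_le fun j hj => ?_
    have : (fun ω => (X j ω, Y j ω)) = (fun p : (ℤ → F) × (ℤ → E) => (p.1 j, p.2 j)) ∘
        fun ω => (τX fun t => X t ω, τY fun t => Y t ω) := by
      ext ω <;> simp [τX, τY, hj]
    change MeasurableSpace.comap (fun ω => (X j ω, Y j ω)) _ ≤ _
    rw [this, ← MeasurableSpace.comap_comp]
    exact MeasurableSpace.comap_mono (Measurable.comap_le (by fun_prop))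
  obtain ⟨G, hG, rfl⟩ := hle A hA
  refine ⟨fun x y => G.indicator (fun _ => (1 : ℝ)) (τX x, τY y), ?_, ?_, ?_, ?_, ?_, ?_⟩
  · exact (measurable_const.indicator hG).comp
      (f := fun p : (ℤ → F) × (ℤ → E) => (τX p.1, τY p.2)) (by fun_prop)
  · intro x y; exact Set.indicator_nonneg (fun _ _ => zero_le_one) _
  · intro x y; exact Set.indicator_le_self' (fun _ _ => zero_le_one) _
  · intro y x x' hx
    have : τX x = τX x' := by
      ext t
      by_cases ht : t ∈ S
      · simpa [τX, ht] using hx t ht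
      · simp [τX, ht]
    simp only [this]
  · intro x y y' hy
    have : τY y = τY y' := by
      ext t
      by_cases ht : t ∈ S
      · simpa [τY, ht] using hy t ht
      · simp [τY, ht]
    simp only [this]
  · intro ω
    rfl

end Window

/-! ### The mixing coefficients of the chain together with its environment -/

section Main

variable {Ω E F : Type*} [MeasurableSpace Ω] {μ : Measure Ω} [IsProbabilityMeasure μ]
    [TopologicalSpace E] [PolishSpace E] [MeasurableSpace E] [BorelSpace E]
    [TopologicalSpace F] [PolishSpace F] [MeasurableSpace F] [BorelSpace F]
    {P : Kernel (F × E) E} [IsMarkovKernel P] {X : ℤ → Ω → F} {Y : ℤ → Ω → E} {m : ℕ}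
    {η : (Fin m → F) → ℝ} {ν : (Fin m → F) → Measure E}

/-- This is `exists_env_approx` for real integrals, where its two one-sided bounds become one
absolute value. -/
lemma exists_env_approx_real (hchain : IsChainInRandomEnv μ P X Y) (hstat : IsStationary μ X)
    (hD : IsDoeblin μ P X m η ν) (c : ℤ) (N k : ℕ) {S : Set ℤ}
    (hS : ∀ i : ℤ, c ≤ i → i < c + N + k → i ∈ S)
    {Φ : (ℤ → F) → (ℤ → E) → ℝ} (hΦ : Measurable (Function.uncurry Φ)) (hΦ0 : ∀ x y, 0 ≤ Φ x y)
    (hΦ1 : ∀ x y, Φ x y ≤ 1) (hΦS : ∀ y, DependsOn (fun x => Φ x y) S)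
    (hdep : ∀ x, DependsOn (Φ x) (Set.Icc (c + N) (c + N + k))) :
    ∃ f : (ℤ → F) → ℝ, Measurable f ∧ (∀ x, 0 ≤ f x) ∧ (∀ x, f x ≤ 1) ∧ DependsOn f S ∧
      ∀ U : (ℤ → F) → (ℤ → E) → ℝ, Measurable (Function.uncurry U) → (∀ x y, 0 ≤ U x y) →
        (∀ x y, U x y ≤ 1) → (∀ x, DependsOn (U x) (Set.Iic c)) →
        |∫ ω, U (fun s => X s ω) (fun s => Y s ω) * Φ (fun s => X s ω) (fun s => Y s ω) ∂μ -
          ∫ ω, U (fun s => X s ω) (fun s => Y s ω) * f (fun s => X s ω) ∂μ| ≤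
            ∫ x, contraction η c (N / m) x ∂(pathLaw μ X) := by
  have hXm : Measurable fun ω t => X t ω := measurable_pi_lambda _ hchain.measurable_env
  have hYm : Measurable fun ω t => Y t ω := measurable_pi_lambda _ hchain.measurable_chain
  obtain ⟨f, hf, hf1, hfS, hfU⟩ := exists_env_approx hchain hstat hD c N k hS
    (Φ := fun x y => ENNReal.ofReal (Φ x y)) hΦ.ennreal_ofReal
    (fun x y => by simpa using hΦ1 x y)
    (fun y x x' h => congrArg ENNReal.ofReal (hΦS y h))
    (fun x y y' h => congrArg ENNReal.ofReal (hdep x h))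
  have hftop : ∀ x, f x ≠ ∞ := fun x => ne_top_of_le_ne_top ENNReal.one_ne_top (hf1 x)
  refine ⟨fun x => (f x).toReal, hf.ennreal_toReal, fun x => ENNReal.toReal_nonneg,
    fun x => ENNReal.toReal_le_of_le_ofReal zero_le_one (by simpa using hf1 x),
    fun x x' h => congrArg ENNReal.toReal (hfS h), fun U hU hU0 hU1 hUd => ?_⟩
  have hXY : Measurable fun ω => ((fun s => X s ω), (fun s => Y s ω)) := hXm.prodMk hYm
  have hUm : Measurable fun ω => U (fun s => X s ω) (fun s => Y s ω) := hU.comp hXY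
  have hΦm : Measurable fun ω => Φ (fun s => X s ω) (fun s => Y s ω) := hΦ.comp hXY
  have hfm : Measurable fun ω => (f (fun s => X s ω)).toReal := (hf.comp hXm).ennreal_toReal
  have hf1' : ∀ x, (f x).toReal ≤ 1 := fun x =>
    ENNReal.toReal_le_of_le_ofReal zero_le_one (by simpa using hf1 x)
  have conv : ∀ u v : Ω → ℝ, Measurable u → Measurable v → (∀ ω, 0 ≤ u ω) → (∀ ω, u ω ≤ 1) →
      (∀ ω, 0 ≤ v ω) → (∀ ω, v ω ≤ 1) →
      ∫⁻ ω, ENNReal.ofReal (u ω) * ENNReal.ofReal (v ω) ∂μ =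
        ENNReal.ofReal (∫ ω, u ω * v ω ∂μ) := by
    intro u v hu hv hu0 hu1 hv0 hv1
    rw [ofReal_integral_eq_lintegral_ofReal (f := fun ω => u ω * v ω) (integrable_of_mem_unitInterval (hu.mul hv)
      (fun ω => mul_nonneg (hu0 ω) (hv0 ω)) fun ω => mul_le_one₀ (hu1 ω) (hv0 ω) (hv1 ω))
      (ae_of_all _ fun ω => mul_nonneg (hu0 ω) (hv0 ω))]
    exact lintegral_congr fun ω => (ENNReal.ofReal_mul (hu0 ω)).symm
  have key := hfU (fun x y => ENNReal.ofReal (U x y)) hU.ennreal_ofReal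
    (fun x y => by simpa using hU1 x y) (fun x y y' h => congrArg ENNReal.ofReal (hUd x h))
  have hd : ∫⁻ x, ENNReal.ofReal (contraction η c (N / m) x) ∂(pathLaw μ X) =
      ENNReal.ofReal (∫ x, contraction η c (N / m) x ∂(pathLaw μ X)) :=
    (ofReal_integral_eq_lintegral_ofReal
      (integrable_contraction hchain.measurable_env hD.measurable_eta hD.eta_mem _ _)
      (ae_of_all _ fun x => contraction_nonneg hD.eta_mem _ _ _)).symm
  have hfe : ∀ ω, f (fun s => X s ω) = ENNReal.ofReal ((f (fun s => X s ω)).toReal) :=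
    fun ω => (ENNReal.ofReal_toReal (hftop _)).symm
  simp only [hd] at key
  have e1 := conv _ _ hUm hΦm (fun _ => hU0 _ _) (fun _ => hU1 _ _) (fun _ => hΦ0 _ _)
    (fun _ => hΦ1 _ _)
  have e2 := conv _ _ hUm hfm (fun _ => hU0 _ _) (fun _ => hU1 _ _)
    (fun _ => ENNReal.toReal_nonneg) (fun _ => hf1' _)
  simp only [← hfe] at e2
  have hd0 : 0 ≤ ∫ x, contraction η c (N / m) x ∂(pathLaw μ X) :=
    integral_nonneg fun x => contraction_nonneg hD.eta_mem _ _ _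
  have i1 : 0 ≤ ∫ ω, U (fun s => X s ω) (fun s => Y s ω) *
      Φ (fun s => X s ω) (fun s => Y s ω) ∂μ :=
    integral_nonneg fun ω => mul_nonneg (hU0 _ _) (hΦ0 _ _)
  have i2 : 0 ≤ ∫ ω, U (fun s => X s ω) (fun s => Y s ω) * (f (fun s => X s ω)).toReal ∂μ :=
    integral_nonneg fun ω => mul_nonneg (hU0 _ _) ENNReal.toReal_nonneg
  rw [e1, e2, ← ENNReal.ofReal_add i2 hd0, ← ENNReal.ofReal_add i1 hd0,
    ENNReal.ofReal_le_ofReal_iff (add_nonneg i2 hd0),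
    ENNReal.ofReal_le_ofReal_iff (add_nonneg i1 hd0)] at key
  rw [abs_le]
  constructor <;> linarith [key.1, key.2]

/-- The mixing coefficient of the chain with its environment is bounded by the one of the
environment and by the expected contraction coefficient. -/
theorem alphaMix_le_add_integral_contraction (hchain : IsChainInRandomEnv μ P X Y)
    (hstat : IsStationary μ X) (hmix : IsStronglyMixing μ X) (hm : 0 < m)
    (hD : IsDoeblin μ P X m η ν) {n r : ℕ} (hrn : r ≤ n) :
    alphaMix μ (fun t ω => (X t ω, Y t ω)) n ≤ alphaMix μ X r +
      2 * ∫ x, contraction η (r : ℤ) ((n - r) / m) x ∂(pathLaw μ X) := by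
  have hX := hchain.measurable_env
  have hXm : Measurable fun ω t => X t ω := measurable_pi_lambda _ hX
  have hne := nonempty_of_isProbabilityMeasure μ
  have hV : ∀ t, Measurable fun ω => (X t ω, Y t ω) := fun t =>
    (hX t).prodMk (hchain.measurable_chain t)
  refine le_of_forall_pos_le_add fun ε hε => alphaMix_le_of_windows hV n fun K L A B hA hB => ?_
  obtain ⟨s, hs⟩ := exists_integral_contraction_le hX hstat hmix hm hD.measurable_eta hD.eta_mem
    (half_pos hε)
  obtain ⟨ΦA, hΦA, hΦA0, hΦA1, hΦAx, hΦAy, hΦAω⟩ := exists_indicator_eq_of_windowSigma hA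
  obtain ⟨ΦB, hΦB, hΦB0, hΦB1, hΦBx, hΦBy, hΦBω⟩ := exists_indicator_eq_of_windowSigma hB
  have hnr : (r : ℤ) + ((n - r : ℕ) : ℤ) = n := by omega
  obtain ⟨fB, hfB, hfB0, hfB1, hfBd, hfBU⟩ := exists_env_approx_real hchain hstat hD r (n - r) L
    (S := Set.Ici (r : ℤ)) (fun i hi _ => hi) hΦB hΦB0 hΦB1
    (fun y => (hΦBx y).mono fun i hi => by simp only [Set.mem_Icc, Set.mem_Ici] at *; omega)
    (fun x => by rw [hnr]; exact hΦBy x)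
  -- Starting `s * m` steps before the window leaves exactly `s` full blocks, enough for an error of
  -- `ε / 2`.
  obtain ⟨fA, hfA, hfA0, hfA1, hfAd, hfAU⟩ := exists_env_approx_real hchain hstat hD
    (-K - (s * m : ℕ)) (s * m) K (S := Set.Iic (0 : ℤ))
    (fun i _ hi => by simp only [Set.mem_Iic]; omega) hΦA hΦA0 hΦA1
    (fun y => (hΦAx y).mono fun i hi => hi.2)
    (fun x => by
      rw [sub_add_cancel, neg_add_cancel]
      exact hΦAy x)
  rw [Nat.mul_div_cancel _ hm] at hfAU
  have hAm := windowSigma_le hV _ _ hA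
  have hBm := windowSigma_le hV _ _ hB
  have b1 := hfBU ΦA hΦA hΦA0 hΦA1 fun x => (hΦAy x).mono fun i hi => by
    simp only [Set.mem_Icc, Set.mem_Iic] at *; omega
  have b2 := hfBU (fun _ _ => 1) measurable_const (fun _ _ => zero_le_one) (fun _ _ => le_rfl)
    (fun x y y' _ => rfl)
  -- The test function `fB` looks at the future of the environment. This is allowed because the
  -- chain is Markov conditionally on the whole of `X`.
  have a1 := (hfAU (fun x _ => fB x) (hfB.comp measurable_fst) (fun x _ => hfB0 x)
    (fun x _ => hfB1 x) (fun x y y' _ => rfl)).trans (hs _)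
  have a2 := (hfAU (fun _ _ => 1) measurable_const (fun _ _ => zero_le_one) (fun _ _ => le_rfl)
    (fun x y y' _ => rfl)).trans (hs _)
  have hcov := abs_integral_mul_sub_le_alphaMix hX hstat 0 r hfA hfA0 hfA1 hfAd hfB hfB0 hfB1
    (by rwa [zero_add])
  have hlaw : ∀ u : (ℤ → F) → ℝ, Measurable u →
      ∫ x, u x ∂(pathLaw μ X) = ∫ ω, u (fun s => X s ω) ∂μ := fun u hu =>
    integral_map hXm.aemeasurable hu.aestronglyMeasurable
  rw [hlaw _ hfA, hlaw _ hfB, hlaw (fun x => fA x * fB x) (hfA.mul hfB)] at hcov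
  have eA : ∫ ω, ΦA (fun s => X s ω) (fun s => Y s ω) ∂μ = μ.real A := by
    simp only [hΦAω]
    rw [integral_indicator_const _ hAm]
    simp
  have eB : ∫ ω, ΦB (fun s => X s ω) (fun s => Y s ω) ∂μ = μ.real B := by
    simp only [hΦBω]
    rw [integral_indicator_const _ hBm]
    simp
  have eAB : ∫ ω, ΦA (fun s => X s ω) (fun s => Y s ω) * ΦB (fun s => X s ω) (fun s => Y s ω) ∂μ =
      μ.real (A ∩ B) := by
    have : ∀ ω, ΦA (fun s => X s ω) (fun s => Y s ω) * ΦB (fun s => X s ω) (fun s => Y s ω) =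
        (A ∩ B).indicator (fun _ => (1 : ℝ)) ω := by
      intro ω
      rw [hΦAω, hΦBω, ← Set.inter_indicator_mul]
      simp
    simp only [this]
    rw [integral_indicator_const _ (hAm.inter hBm)]
    simp
  have c1 : ∫ ω, fB (fun s => X s ω) * ΦA (fun s => X s ω) (fun s => Y s ω) ∂μ =
      ∫ ω, ΦA (fun s => X s ω) (fun s => Y s ω) * fB (fun s => X s ω) ∂μ := by
    simp only [mul_comm]
  have c2 : ∫ ω, fB (fun s => X s ω) * fA (fun s => X s ω) ∂μ =
      ∫ ω, fA (fun s => X s ω) * fB (fun s => X s ω) ∂μ := by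
    simp only [mul_comm]
  simp only [one_mul] at a2 b2
  rw [eAB] at b1
  rw [eB] at b2
  rw [c1, c2] at a1
  rw [eA] at a2
  set d := ∫ x, contraction η (r : ℤ) ((n - r) / m) x ∂(pathLaw μ X)
  set IA := ∫ ω, fA (fun s => X s ω) ∂μ
  set IB := ∫ ω, fB (fun s => X s ω) ∂μ
  have A0 : 0 ≤ μ.real A := measureReal_nonneg
  have A1 : μ.real A ≤ 1 := measureReal_le_one
  have IB0 : 0 ≤ IB := integral_nonneg fun ω => hfB0 _
  have IB1 : IB ≤ 1 := by
    have := integral_mono (μ := μ) (integrable_of_mem_unitInterval (hfB.comp hXm)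
      (fun _ => hfB0 _) (fun _ => hfB1 _)) (integrable_const (1 : ℝ)) (fun ω => hfB1 fun s => X s ω)
    simpa using this
  have h4 : |μ.real A * μ.real B - IA * IB| ≤ ε / 2 + d := by
    have e : μ.real A * μ.real B - IA * IB =
        (μ.real A - IA) * IB + μ.real A * (μ.real B - IB) := by ring
    rw [e]
    refine (abs_add_le _ _).trans ?_
    rw [abs_mul, abs_mul, abs_of_nonneg A0, abs_of_nonneg IB0]
    have := mul_le_mul a2 IB1 IB0 ((abs_nonneg _).trans a2)
    have := mul_le_mul A1 b2 (abs_nonneg _) zero_le_one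
    linarith
  -- The errors are `d` and `ε / 2` for the intersection, `α_X(r)` for the environment, and again
  -- `d` and `ε / 2` for the product.
  rw [abs_le] at *
  constructor <;> linarith [a1.1, a1.2, b1.1, b1.2, hcov.1, hcov.2, h4.1, h4.2]

end Main

/-! ### Rates of decay -/

section Rates

/-- With `j = ⌊y⌋₊ + 1` the retained blocks are at least `y` apart. -/
lemma floor_add_one_mul_ge {m : ℕ} (hm : 0 < m) {y : ℝ} : y ≤ ((⌊y⌋₊ * m + 1 : ℕ) : ℝ) := by
  have h1 := (Nat.lt_floor_add_one y).le
  have h2 : ((⌊y⌋₊ + 1 : ℕ) : ℝ) ≤ ((⌊y⌋₊ * m + 1 : ℕ) : ℝ) := by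
    exact_mod_cast Nat.add_le_add_right (Nat.le_mul_of_pos_right _ hm) 1
  push_cast at h2 ⊢
  linarith

/-- Here `j ≤ 2 * y` and about `n / 2` time units are available, which gives `4 * m * y`; the `2`
absorbs the roundings. -/
lemma div_floor_ge {m : ℕ} (hm : 0 < m) {n : ℕ} {y : ℝ} (hy : 1 ≤ y) :
    (n : ℝ) / (4 * m * y) - 2 ≤ (((n - (n + 1) / 2) / m / (⌊y⌋₊ + 1) : ℕ) : ℝ) := by
  have hm' : (1 : ℝ) ≤ m := by exact_mod_cast hm
  set j := ⌊y⌋₊ + 1 with hj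
  have hj1 : (1 : ℝ) ≤ j := by rw [hj]; push_cast; linarith [Nat.cast_nonneg (α := ℝ) ⌊y⌋₊]
  have hj2 : (j : ℝ) ≤ 2 * y := by
    rw [hj]; push_cast; linarith [Nat.floor_le (zero_le_one.trans hy)]
  have hmj : (1 : ℝ) ≤ m * j := by nlinarith
  rw [Nat.div_div_eq_div_mul]
  have h1 := Nat.lt_floor_add_one (((n - (n + 1) / 2 : ℕ) : ℝ) / ((m * j : ℕ) : ℝ))
  rw [Nat.floor_div_eq_div] at h1
  have h2 : (n : ℝ) / 2 - 1 ≤ ((n - (n + 1) / 2 : ℕ) : ℝ) := by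
    have : n ≤ 2 * (n - (n + 1) / 2) + 2 := by omega
    have : (n : ℝ) ≤ 2 * ((n - (n + 1) / 2 : ℕ) : ℝ) + 2 := by exact_mod_cast this
    linarith
  have h3 : (n : ℝ) / (4 * m * y) - 1 ≤ ((n - (n + 1) / 2 : ℕ) : ℝ) / ((m * j : ℕ) : ℝ) := by
    push_cast
    rw [le_div_iff₀ (by linarith), sub_mul]
    have h4 : (n : ℝ) / (4 * m * y) * (m * j) ≤ n / 2 := by
      rw [div_mul_eq_mul_div, div_le_div_iff₀ (by positivity) two_pos]
      have : (n : ℝ) * (m * j) ≤ n * (m * (2 * y)) := by gcongr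
      linarith
    linarith
  linarith

lemma isBigO_rpow_rpow {q c δ : ℝ} (hq0 : 0 < q) (hq1 : q < 1) (hc : 0 < c) (hδ : 0 < δ) (s : ℝ) :
    (fun n : ℕ => q ^ (c * (n : ℝ) ^ δ)) =O[atTop] fun n : ℕ => (n : ℝ) ^ s := by
  have ha : 0 < -Real.log q * c := mul_pos (neg_pos.2 (Real.log_neg hq0 hq1)) hc
  have h := ((isLittleO_exp_neg_mul_rpow_atTop ha (s / δ)).isBigO).comp_tendsto
    ((tendsto_rpow_atTop hδ).comp tendsto_natCast_atTop_atTop)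
  refine (h.congr (fun n => ?_) fun n => ?_)
  · simp only [Function.comp_apply]
    rw [Real.rpow_def_of_pos hq0]
    congr 1
    ring
  · simp only [Function.comp_apply]
    rw [← Real.rpow_mul (Nat.cast_nonneg n), mul_div_cancel₀ _ hδ.ne']

variable {a α : ℕ → ℝ} {ρ : ℝ} {m : ℕ}

/-- Take `y = n ^ θ` with `θ = κ' / κ < 1`. The mixing term becomes `n ^ (-κ')`, while the power of
`ρ` has an exponent of order `n ^ (1 - θ)` and decays faster than any power of `n`. -/
lemma isBigO_rpow_of_mixing_bound (hm : 0 < m) (hρ : ρ ∈ Set.Ioo (0 : ℝ) 1) (ha0 : ∀ n, 0 ≤ a n)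
    (hα0 : ∀ n, 0 ≤ α n)
    (h : ∀ n : ℕ, ∀ y : ℝ, 1 ≤ y → a n ≤ α ((n + 1) / 2) +
      2 * (ρ ^ ((n : ℝ) / (4 * m * y) - 2) + α (⌊y⌋₊ * m + 1) / (1 - ρ)))
    {κ κ' : ℝ} (hκ' : 1 < κ') (hκ : κ' < κ) (hα : α =O[atTop] fun n : ℕ => (n : ℝ) ^ (-κ)) :
    a =O[atTop] fun n : ℕ => (n : ℝ) ^ (-κ') := by
  have hκ0 : 0 < κ := by linarith
  have h1ρ : 0 < 1 - ρ := sub_pos.2 hρ.2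
  have hm0 : (0 : ℝ) < m := by exact_mod_cast hm
  obtain ⟨C, hC, hCα⟩ := bound_of_isBigO_nat_atTop hα
  have hCα' : ∀ (k : ℕ) (z : ℝ), 0 < z → z ≤ k → α k ≤ C * z ^ (-κ) := by
    intro k z hz hzk
    have hk : (0 : ℝ) < k := hz.trans_le hzk
    have := hCα (Real.rpow_pos_of_pos hk (-κ)).ne'
    rw [Real.norm_of_nonneg (hα0 k), Real.norm_of_nonneg (Real.rpow_nonneg hk.le _)] at this
    exact this.trans (mul_le_mul_of_nonneg_left
      (Real.rpow_le_rpow_of_nonpos hz hzk (by linarith)) hC.le)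
  set θ := κ' / κ with hθ
  have hθ0 : 0 < θ := by positivity
  have hθ1 : θ < 1 := (div_lt_one hκ0).2 hκ
  have hθκ : θ * -κ = -κ' := by rw [hθ]; field_simp
  have hexp := isBigO_rpow_rpow hρ.1 hρ.2 (show (0 : ℝ) < 1 / (4 * m) by positivity)
    (sub_pos.2 hθ1) (-κ')
  have hbig : (fun n : ℕ => C * 2 ^ κ * (n : ℝ) ^ (-κ') +
      2 * (ρ ^ (-2 : ℝ) * ρ ^ (1 / (4 * m) * (n : ℝ) ^ (1 - θ)) +
        C / (1 - ρ) * (n : ℝ) ^ (-κ'))) =O[atTop] fun n : ℕ => (n : ℝ) ^ (-κ') := by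
    have hself := isBigO_refl (fun n : ℕ => (n : ℝ) ^ (-κ')) atTop
    exact (hself.const_mul_left _).add (((hexp.const_mul_left _).add
      (hself.const_mul_left _)).const_mul_left _)
  refine IsBigO.trans (IsBigO.of_bound 1 ?_) hbig
  filter_upwards [eventually_ge_atTop 1] with n hn
  have hn1 : (1 : ℝ) ≤ n := by exact_mod_cast hn
  have hn0 : (0 : ℝ) < n := by linarith
  have hy : 1 ≤ (n : ℝ) ^ θ := Real.one_le_rpow hn1 hθ0.le
  have hb := h n _ hy
  have t1 : α ((n + 1) / 2) ≤ C * 2 ^ κ * (n : ℝ) ^ (-κ') := by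
    refine (hCα' _ ((n : ℝ) / 2) (by positivity) ?_).trans ?_
    · have : n ≤ 2 * ((n + 1) / 2) := by omega
      have : (n : ℝ) ≤ 2 * (((n + 1) / 2 : ℕ) : ℝ) := by exact_mod_cast this
      linarith
    · rw [Real.div_rpow hn0.le two_pos.le, Real.rpow_neg two_pos.le, div_inv_eq_mul, mul_assoc,
        mul_comm ((2 : ℝ) ^ κ)]
      gcongr
  have t2 : α (⌊(n : ℝ) ^ θ⌋₊ * m + 1) / (1 - ρ) ≤ C / (1 - ρ) * (n : ℝ) ^ (-κ') := by
    rw [div_mul_eq_mul_div]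
    gcongr
    refine (hCα' _ _ (by positivity) (floor_add_one_mul_ge hm)).trans ?_
    rw [← Real.rpow_mul hn0.le, hθκ]
  have t3 : ρ ^ ((n : ℝ) / (4 * m * (n : ℝ) ^ θ) - 2) =
      ρ ^ (-2 : ℝ) * ρ ^ (1 / (4 * m) * (n : ℝ) ^ (1 - θ)) := by
    rw [← Real.rpow_add hρ.1, Real.rpow_sub hn0, Real.rpow_one]
    congr 1
    field_simp
    ring
  rw [t3] at hb
  rw [one_mul, Real.norm_of_nonneg (ha0 n)]
  exact (hb.trans (by gcongr)).trans (Real.le_norm_self _)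

/-- The choice `y = √n` balances the exponents `n / y` and `y`. -/
lemma exists_isBigO_rpow_sqrt_of_mixing_bound (hm : 0 < m) (hρ : ρ ∈ Set.Ioo (0 : ℝ) 1)
    (ha0 : ∀ n, 0 ≤ a n) (hα0 : ∀ n, 0 ≤ α n)
    (h : ∀ n : ℕ, ∀ y : ℝ, 1 ≤ y → a n ≤ α ((n + 1) / 2) +
      2 * (ρ ^ ((n : ℝ) / (4 * m * y) - 2) + α (⌊y⌋₊ * m + 1) / (1 - ρ)))
    {κ : ℝ} (hκ0 : 0 < κ) (hκ1 : κ < 1) (hα : α =O[atTop] fun n : ℕ => κ ^ n) :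
    ∃ κbar : ℝ, 0 < κbar ∧ κbar < 1 ∧ a =O[atTop] fun n : ℕ => κbar ^ Real.sqrt n := by
  have h1ρ : 0 < 1 - ρ := sub_pos.2 hρ.2
  have hm0 : (0 : ℝ) < m := by exact_mod_cast hm
  obtain ⟨C, hC, hCα⟩ := bound_of_isBigO_nat_atTop hα
  have hCα' : ∀ (k : ℕ) (z : ℝ), z ≤ k → α k ≤ C * κ ^ z := by
    intro k z hzk
    have := hCα (x := k) (pow_pos hκ0 k).ne'
    rw [Real.norm_of_nonneg (hα0 k), Real.norm_of_nonneg (pow_pos hκ0 k).le,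
      ← Real.rpow_natCast] at this
    exact this.trans (mul_le_mul_of_nonneg_left
      (Real.rpow_le_rpow_of_exponent_ge hκ0 hκ1.le hzk) hC.le)
  -- The exponent `1 / 2` comes from evaluating `α` at `(n + 1) / 2`, and `1 / (4 * m)` from the
  -- number of retained blocks.
  set b := max (κ ^ (1 / 2 : ℝ)) (ρ ^ (1 / (4 * m) : ℝ)) with hb
  have hb0 : 0 < b := lt_max_of_lt_left (Real.rpow_pos_of_pos hκ0 _)
  have hb1 : b < 1 := max_lt (Real.rpow_lt_one hκ0.le hκ1 (by norm_num))
    (Real.rpow_lt_one hρ.1.le hρ.2 (by positivity))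
  refine ⟨b, hb0, hb1, IsBigO.of_bound (C + 2 * (ρ ^ (-2 : ℝ) + C / (1 - ρ))) ?_⟩
  filter_upwards [eventually_ge_atTop 1] with n hn
  have hn1 : (1 : ℝ) ≤ n := by exact_mod_cast hn
  have hn0 : (0 : ℝ) < n := by linarith
  have hy : 1 ≤ Real.sqrt n := Real.one_le_sqrt.2 hn1
  have hyn : Real.sqrt n ≤ n := by
    rw [Real.sqrt_le_left hn0.le]; nlinarith
  have hκb : κ ^ (1 / 2 * Real.sqrt n) ≤ b ^ Real.sqrt n := by
    rw [Real.rpow_mul hκ0.le]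
    exact Real.rpow_le_rpow (Real.rpow_nonneg hκ0.le _) (le_max_left _ _) (by positivity)
  have hbd := h n _ hy
  have t1 : α ((n + 1) / 2) ≤ C * b ^ Real.sqrt n := by
    refine (hCα' _ (1 / 2 * Real.sqrt n) ?_).trans (by gcongr)
    have : n ≤ 2 * ((n + 1) / 2) := by omega
    have : (n : ℝ) ≤ 2 * (((n + 1) / 2 : ℕ) : ℝ) := by exact_mod_cast this
    linarith
  have t2 : α (⌊Real.sqrt n⌋₊ * m + 1) / (1 - ρ) ≤ C / (1 - ρ) * b ^ Real.sqrt n := by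
    rw [div_mul_eq_mul_div]
    gcongr
    refine (hCα' _ (1 / 2 * Real.sqrt n) ?_).trans (by gcongr)
    linarith [floor_add_one_mul_ge hm (y := Real.sqrt n)]
  have t3 : ρ ^ ((n : ℝ) / (4 * m * Real.sqrt n) - 2) ≤ ρ ^ (-2 : ℝ) * b ^ Real.sqrt n := by
    have e : (n : ℝ) / (4 * m * Real.sqrt n) - 2 = -2 + 1 / (4 * m) * Real.sqrt n := by
      rw [mul_comm (4 * (m : ℝ)), ← div_div, Real.div_sqrt]
      ring
    rw [e, Real.rpow_add hρ.1, Real.rpow_mul hρ.1.le]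
    exact mul_le_mul_of_nonneg_left (Real.rpow_le_rpow (Real.rpow_nonneg hρ.1.le _)
      (le_max_right _ _) (by positivity)) (Real.rpow_nonneg hρ.1.le _)
  rw [Real.norm_of_nonneg (ha0 n), Real.norm_of_nonneg (Real.rpow_nonneg hb0.le _)]
  calc a n ≤ _ := hbd
    _ ≤ C * b ^ Real.sqrt n + 2 * (ρ ^ (-2 : ℝ) * b ^ Real.sqrt n +
        C / (1 - ρ) * b ^ Real.sqrt n) := by gcongr
    _ = _ := by ring

end Rates

end MCRE

end

/-! ### The mixing bound and the two rates -/

theorem theorem1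
    {Ω E F : Type*} [MeasurableSpace Ω] (μ : Measure Ω) [IsProbabilityMeasure μ]
    [TopologicalSpace E] [PolishSpace E] [MeasurableSpace E] [BorelSpace E]
    [TopologicalSpace F] [PolishSpace F] [MeasurableSpace F] [BorelSpace F]
    (P : Kernel (F × E) E) [IsMarkovKernel P]
    (X : ℤ → Ω → F) (Y : ℤ → Ω → E)
    (hchain : MCRE.IsChainInRandomEnv μ P X Y)
    (hstatV : MCRE.IsStationary μ (fun t ω => (X t ω, Y t ω)))
    (hstatX : MCRE.IsStationary μ X)
    (hmixX : MCRE.IsStronglyMixing μ X)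
    (m : ℕ) (hm : 0 < m)
    (η : (Fin m → F) → ℝ) (ν : (Fin m → F) → Measure E)
    (hDoeblin : MCRE.IsDoeblin μ P X m η ν)
    (ρ : ℝ) (hρ : ρ = 1 - ∫ ω, η (MCRE.envBlock X m 0 ω) ∂μ) :
    (∀ n r : ℕ, 1 ≤ r → r < n →
      ENNReal.ofReal (MCRE.alphaMix μ (fun t ω => (X t ω, Y t ω)) n) ≤
        4 * ENNReal.ofReal (MCRE.alphaMix μ X r) +
          2 * ∑' t : Set.Ici n,
            MCRE.infTerm (MCRE.alphaMix μ X) ρ m (((t : ℕ) - r) / m)) ∧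
    (∀ κ : ℝ, 1 < κ →
      (MCRE.alphaMix μ X =O[atTop] fun n : ℕ => (n : ℝ) ^ (-κ)) →
      ∀ κ' : ℝ, 1 < κ' → κ' < κ →
        MCRE.IsStronglyMixing μ (fun t ω => (X t ω, Y t ω)) ∧
        MCRE.alphaMix μ (fun t ω => (X t ω, Y t ω)) =O[atTop]
          fun n : ℕ => (n : ℝ) ^ (-κ' + 1)) ∧
    (∀ κ : ℝ, 0 < κ → κ < 1 →
      (MCRE.alphaMix μ X =O[atTop] fun n : ℕ => κ ^ n) →
      ∃ κbar : ℝ, 0 < κbar ∧ κbar < 1 ∧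
        MCRE.alphaMix μ (fun t ω => (X t ω, Y t ω)) =O[atTop]
          fun n : ℕ => κbar ^ Real.sqrt n) := by
  have hX := hchain.measurable_env
  have hη := hDoeblin.measurable_eta
  have hη01 := hDoeblin.eta_mem
  have hρ01 := MCRE.rho_mem_Ioo (μ := μ) hX hη hη01
  rw [← hρ] at hρ01
  have h1ρ : 0 < 1 - ρ := sub_pos.2 hρ01.2
  have hα0 : ∀ n, 0 ≤ MCRE.alphaMix μ X n := fun n => MCRE.alphaMix_nonneg n
  have hV0 : ∀ n, 0 ≤ MCRE.alphaMix μ (fun t ω => (X t ω, Y t ω)) n := fun n =>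
    MCRE.alphaMix_nonneg n
  -- Half of the time, `r = (n + 1) / 2`, goes to the mixing of `X` and the other half to
  -- contraction with `j = ⌊y⌋₊ + 1`.
  have hbound : ∀ n : ℕ, ∀ y : ℝ, 1 ≤ y →
      MCRE.alphaMix μ (fun t ω => (X t ω, Y t ω)) n ≤ MCRE.alphaMix μ X ((n + 1) / 2) +
        2 * (ρ ^ ((n : ℝ) / (4 * m * y) - 2) +
          MCRE.alphaMix μ X (⌊y⌋₊ * m + 1) / (1 - ρ)) := by
    intro n y hy
    refine (MCRE.alphaMix_le_add_integral_contraction hchain hstatX hmixX hm hDoeblin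
      (n := n) (r := (n + 1) / 2) (by omega)).trans ?_
    gcongr
    refine (MCRE.integral_contraction_le hX hstatX hη hη01 hρ _ _ (j := ⌊y⌋₊ + 1)
      (by omega)).trans ?_
    rw [Nat.add_sub_cancel, ← Real.rpow_natCast]
    exact add_le_add (Real.rpow_le_rpow_of_exponent_ge hρ01.1 hρ01.2.le
      (MCRE.div_floor_ge hm hy)) le_rfl
  refine ⟨fun n r _ hrn => ?_, fun κ hκ hα κ' hκ' hκκ' => ?_, fun κ hκ0 hκ1 hα => ?_⟩
  · have hd0 : 0 ≤ ∫ x, MCRE.contraction η (r : ℤ) ((n - r) / m) x ∂(MCRE.pathLaw μ X) :=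
      integral_nonneg fun x => MCRE.contraction_nonneg hη01 _ _ _
    have hle : ENNReal.ofReal
        (∫ x, MCRE.contraction η (r : ℤ) ((n - r) / m) x ∂(MCRE.pathLaw μ X)) ≤
          MCRE.infTerm (MCRE.alphaMix μ X) ρ m ((n - r) / m) := by
      refine le_iInf₂ fun j hj => ENNReal.ofReal_le_ofReal ?_
      refine (MCRE.integral_contraction_le hX hstatX hη hη01 hρ _ _ hj.1).trans ?_
      have := div_nonneg (hα0 ((j - 1) * m + 1)) h1ρ.le
      linarith
    calc ENNReal.ofReal (MCRE.alphaMix μ (fun t ω => (X t ω, Y t ω)) n)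
        ≤ ENNReal.ofReal (MCRE.alphaMix μ X r +
          2 * ∫ x, MCRE.contraction η (r : ℤ) ((n - r) / m) x ∂(MCRE.pathLaw μ X)) :=
          ENNReal.ofReal_le_ofReal (MCRE.alphaMix_le_add_integral_contraction hchain hstatX hmixX
            hm hDoeblin hrn.le)
      _ = 1 * ENNReal.ofReal (MCRE.alphaMix μ X r) + 2 * ENNReal.ofReal
          (∫ x, MCRE.contraction η (r : ℤ) ((n - r) / m) x ∂(MCRE.pathLaw μ X)) := by
          rw [ENNReal.ofReal_add (hα0 r) (by positivity), ENNReal.ofReal_mul two_pos.le]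
          simp
      _ ≤ _ := by
          gcongr
          · norm_num
          -- The term `t = n` alone dominates the contraction error.
          · exact hle.trans (ENNReal.le_tsum (f := fun t : Set.Ici n =>
              MCRE.infTerm (MCRE.alphaMix μ X) ρ m (((t : ℕ) - r) / m)) ⟨n, Set.self_mem_Ici⟩)
  · have hO := MCRE.isBigO_rpow_of_mixing_bound hm hρ01 hV0 hα0 hbound hκ' hκκ' hα
    -- With no series to sum, the rate is `n ^ (-κ')`, one power better than required.
    have hle : (fun n : ℕ => (n : ℝ) ^ (-κ')) =O[atTop] fun n : ℕ => (n : ℝ) ^ (-κ' + 1) := by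
      refine IsBigO.of_bound 1 ?_
      filter_upwards [eventually_ge_atTop 1] with n hn
      have hn1 : (1 : ℝ) ≤ n := by exact_mod_cast hn
      rw [one_mul, Real.norm_of_nonneg (by positivity), Real.norm_of_nonneg (by positivity)]
      exact Real.rpow_le_rpow_of_exponent_le hn1 (by linarith)
    exact ⟨hO.trans_tendsto ((tendsto_rpow_neg_atTop (by linarith)).comp
      tendsto_natCast_atTop_atTop), hO.trans hle⟩
  · exact MCRE.exists_isBigO_rpow_sqrt_of_mixing_bound hm hρ01 hV0 hα0 hbound hκ0 hκ1 hα
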